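/- **Setting.** Let $n\ge 3$ and let $s=(s_{ab})_{1\le a,b\le n}$ be a complex matrix of massless Mandelstam invariants: $s_{ab}=s_{ba}$, $s_{aa}=0$, $\sum_b s_{ab}=0$ for all $a$. Let $1<j<k\le n$ and put $i=1$. The $(1,j,k)$ split kinematics subspace is given by $s_{ab}=0$ whenever $a,b$ lie in different ones of the three open chambers $\{2,\dots,j-1\}$, $\{j+1,\dots,k-1\}$, $\{k+1,\dots,n\}$. **CHY integrals.** For a finite set $L$ of legs, a symmetric coefficient matrix $c$ and three distinct legs $p,q,r$, put $\sigma_p=0$, $\sigma_q=1$, $\sigma_r=\infty$; the other (free) punctures are finite, and $|a\,b|$ denotes the Plücker coordinate $x_ay_b-x_by_a$ of the punctures with homogeneous coordinates $(x,y)=(\sigma_a,1)$, respectively $(1,0)$ for $\sigma=\infty$ (so $|a\,b|=\sigma_a-\sigma_b$ for finite punctures). With the potential $\mathcal S=\sum_{a<b}c_{ab}\log|a\,b|$, the integral $\int\prod_{a\ne p,q,r}d\sigma_a\,\delta(\partial\mathcal S/\partial\sigma_a)\,F$ is the sum, over all solutions of $\partial\mathcal S/\partial\sigma_a=0$ ($a\neq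 p,q,r$) with pairwise distinct punctures, of $F/\det(\partial^2\mathcal S/\partial\sigma_a\partial\sigma_b)$. The integral is called regular if there are finitely many solutions and the determinant is nonzero at each of them (by convention a term with vanishing determinant counts as $0$, and so does a sum with infinitely many nonzero terms). Write $\Delta=|p\,q||q\,r||r\,p|$; let $\mathbf A$ have entries $2p_a\cdot p_b/|a\,b|$ for $a\ne b$ (that is, $s_{ab}/|a\,b|$ for massless legs) and $0$ on the diagonal, and let $\mathbf A^{[\dots]}$ denote removal of the indicated rows and columns. **Amplitude.** With $c=s$, for distinct $p,q,r$ and $a\ne b$ in $\{1,\dots,n\}$, $$A_n^{\rm sGal}=\int\prod_{c\ne p,q,r}d\sigma_c\,\delta\!\left(\frac{\partial\mathcal S}{\partial\sigma_c}\right)\left(\frac{\Delta}{|a\,b|^2}\det\mathbf A^{[a\,b]}\right)^2 .$$ **Amputated currents.** For a set $T$ of particles consider the legs $T\cup\{Q\}$, where $Q$ is an off-shell leg with momentum $P_Q=-\sum_{a\in T}p_a$, so that $2p_a\cdot P_Q=-\sum_{b\in T}s_{ab}$ and $2P_Q^2=\sum_{a,b\in T}s_{ab}$. For gauge-fixed legs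 $p,q,r$ including $Q$, use the potential with coefficients $2p_a\cdot p_b$, to which $p_p^2+p_q^2-p_r^2$ is added for the pair $\{p,q\}$, and cyclically for $\{q,r\}$, $\{r,p\}$. Then: * $\mathcal J^{\rm sGal}_{j+1}$ has $T=\{1,\dots,j\}$, off-shell leg $K$, $(\sigma_1,\sigma_j,\sigma_K)=(0,1,\infty)$ and $F=\left(\Delta\,|1\,K|^{-2}\det\mathbf A^{[1K]}\right)^2$; * $\mathcal J^{{\rm sGal}\oplus\phi^3}_{k-j+2}(\beta_1)$ has $T=\{j,\dots,k\}$, off-shell leg $I$, $(\sigma_I,\sigma_j,\sigma_k)=(0,1,\infty)$, $\beta_1=(I,j,k)$ and $F=\left(\Delta\,{\rm PT}_{\beta_1}\det\mathbf A^{[I\,j\,k]}\right)^2$; * $\mathcal J^{{\rm sGal}\oplus\phi^3}_{n-k+3}(\beta_2)$ has $T=\{k,\dots,n,1\}$, off-shell leg $J$, $(\sigma_1,\sigma_J,\sigma_k)=(0,1,\infty)$, $\beta_2=(1,J,k)$ and $F=\left(\Delta\,{\rm PT}_{\beta_2}\det\mathbf A^{[1\,J\,k]}\right)^2$; here ${\rm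 PT}_{(x,y,z)}=1/(|x\,y||y\,z||z\,x|)$. **Claim.** Let $s$ lie on the $(1,j,k)$ split kinematics subspace. 1. Suppose $j$ is odd and $k$ is even, and that $s$ is generic in the following sense: in the gauge $(\sigma_1,\sigma_j,\sigma_k)=(0,1,\infty)$, every solution of the scattering equations whose punctures are pairwise distinct except possibly for punctures of labels in different open chambers has all its punctures distinct. Then, for every choice of distinct gauge-fixed labels $p,q,r$ and of removed labels $a\ne b$, the CHY formula evaluated at $s$ itself (no limit is taken) gives $$A_n^{\rm sGal}\big|_{\rm split\ kin.}=\mathcal J^{\rm sGal}_{j+1}\times\mathcal J^{{\rm sGal}\oplus\phi^3}_{k-j+2}(\beta_1)\times\mathcal J^{{\rm sGal}\oplus\phi^3}_{n-k+3}(\beta_2).$$ 2. If $j$ and $k$ are both odd, then $A_n^{\rm sGal}|_{\rm split\ kin.}=0$, for every choice of $p,q,r$ and $a\neq b$. 3. For all $j,k$: if the CHY integrals with the potentials and gauges of the three currents are regular, then so is the CHY integral of the amplitude at $s$, in every gauge $p,q,r$. 4. This holds although propagators are singular on the subspace: for every set $S$ of labels that are pairwise in different open chambers, the channel invariant $P_S^2=\sum_{a<b,\;a,b\in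 S}s_{ab}$ vanishes. -/

import Mathlib

open Finset

noncomputable section

namespace Split

section CHY

variable {ι : Type} [Fintype ι] [DecidableEq ι]

/-- Pluecker coordinate of two punctures of the projective line, the puncture of leg `a` having
homogeneous coordinates `u a`. For `u a = (σ, 1)` and `u b = (τ, 1)` it is `σ - τ`. -/
def bracket (u : ι → ℂ × ℂ) (a b : ι) : ℂ :=
  (u a).1 * (u b).2 - (u b).1 * (u a).2

/-- The gauge in which the legs `p, q, r` sit at `0, 1, ∞`; every other leg `a` sits at the finite
point with affine coordinate `(u a).1`. -/
structure GaugeFixed (p q r : ι) (u : ι → ℂ × ℂ) : Prop where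
  zero : u p = (0, 1)
  one : u q = (1, 1)
  infty : u r = (1, 0)
  affine : ∀ a, a ≠ p → a ≠ q → a ≠ r → (u a).2 = 1

/-- The legs whose punctures are integrated over. -/
abbrev Free (p q r : ι) : Type := {a : ι // a ≠ p ∧ a ≠ q ∧ a ≠ r}

/-- Derivative, with respect to the affine coordinate of leg `a`, of the CHY potential
`∑_{a < b} c a b * log |a b|`. -/
def scatteringFn (c : Matrix ι ι ℂ) (u : ι → ℂ × ℂ) (a : ι) : ℂ :=
  ∑ b ∈ univ.erase a, c a b * (u b).2 / bracket u a b

/-- The Hessian of the CHY potential in the affine coordinates of the free legs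
(see `hasDerivAt_scatteringFn`). -/
def chyJacobian (c : Matrix ι ι ℂ) (p q r : ι) (u : ι → ℂ × ℂ) :
    Matrix (Free p q r) (Free p q r) ℂ := fun a b =>
  if a = b then -∑ d ∈ univ.erase (a : ι), c a d * (u d).2 ^ 2 / bracket u a d ^ 2
  else c a b / bracket u a b ^ 2

/-- The `(a, b)` entry of the Hessian is the derivative of the scattering function of leg `a` with
respect to the affine coordinate of leg `b`. -/
theorem hasDerivAt_scatteringFn (c : Matrix ι ι ℂ) (p q r : ι) (u : ι → ℂ × ℂ)
    (hu : GaugeFixed p q r u) (hne : ∀ a b, a ≠ b → bracket u a b ≠ 0) (a b : Free p q r) :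
    HasDerivAt (fun t : ℂ => scatteringFn c (Function.update u (b : ι) (t, 1)) a)
      (chyJacobian c p q r u a b) (u b).1 := by
  have ha1 : (u a).2 = 1 := hu.affine a a.2.1 a.2.2.1 a.2.2.2
  have hb1 : (u b).2 = 1 := hu.affine b b.2.1 b.2.2.1 b.2.2.2
  unfold scatteringFn chyJacobian
  by_cases hab : a = b
  · subst hab
    rw [if_pos rfl, ← Finset.sum_neg_distrib]
    apply HasDerivAt.fun_sum
    intro d hd
    have hda : d ≠ (a : ι) := (Finset.mem_erase.1 hd).1
    have hbr := hne a d hda.symm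
    simp only [bracket, Function.update_self, Function.update_of_ne hda, mul_one] at hbr ⊢
    rw [ha1, mul_one] at hbr
    rw [ha1, mul_one]
    have h1 : HasDerivAt (fun t : ℂ => t * (u d).2 - (u d).1) ((u d).2) (u a).1 := by
      simpa using ((hasDerivAt_id (u a).1).mul_const (u d).2).sub_const (u d).1
    have h2 := (hasDerivAt_const (u a).1 (c a d * (u d).2)).div h1 hbr
    refine h2.congr_deriv ?_
    ring
  · have hab' : (a : ι) ≠ b := fun h => hab (Subtype.ext h)
    rw [if_neg hab]
    have hmem : (b : ι) ∈ univ.erase (a : ι) := by simp [hab'.symm]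
    have hsplit : ∀ t : ℂ, ∑ d ∈ univ.erase (a : ι), c a d *
          (Function.update u (b : ι) (t, 1) d).2 /
            bracket (Function.update u (b : ι) (t, 1)) a d
        = c a b / ((u a).1 - t) + ∑ d ∈ (univ.erase (a : ι)).erase (b : ι),
          c a d * (u d).2 / bracket u a d := by
      intro t
      rw [← Finset.add_sum_erase _ _ hmem]
      congr 1
      · simp [bracket, Function.update_of_ne hab', ha1]
      · apply Finset.sum_congr rfl
        intro d hd
        have hdb : d ≠ (b : ι) := (Finset.mem_erase.1 hd).1
        simp [bracket, Function.update_of_ne hab', Function.update_of_ne hdb]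
    simp only [hsplit]
    have hbr := hne a b hab'
    simp only [bracket, ha1, hb1, mul_one] at hbr ⊢
    have h1 : HasDerivAt (fun t : ℂ => (u a).1 - t) (-1) (u b).1 := by
      simpa using (hasDerivAt_id (u b).1).const_sub (u a).1
    have h2 := ((hasDerivAt_const (u b).1 (c a b)).div h1 hbr).add_const
      (∑ d ∈ (univ.erase (a : ι)).erase (b : ι),
          c a d * (u d).2 / ((u a).1 * (u d).2 - (u d).1))
    refine h2.congr_deriv ?_
    ring

/-- Solutions of the scattering equations in the moduli space of pairwise distinct punctures. -/
def chySolutions (c : Matrix ι ι ℂ) (p q r : ι) : Set (ι → ℂ × ℂ) :=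
  {u | GaugeFixed p q r u ∧ (∀ a b, a ≠ b → bracket u a b ≠ 0) ∧
    ∀ a, a ≠ p → a ≠ q → a ≠ r → scatteringFn c u a = 0}

/-- The integral `∫ ∏ dσ_a δ(∂S/∂σ_a) F` over the free punctures: the sum over the solutions
of the scattering equations of `F` divided by the Jacobian determinant. -/
def chyIntegral (c : Matrix ι ι ℂ) (p q r : ι) (F : (ι → ℂ × ℂ) → ℂ) : ℂ :=
  ∑ᶠ u ∈ chySolutions c p q r, F u / (chyJacobian c p q r u).det

/-- The delta functions are honest: finitely many solutions, all nondegenerate. -/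
def CHYRegular (c : Matrix ι ι ℂ) (p q r : ι) : Prop :=
  (chySolutions c p q r).Finite ∧
    ∀ u ∈ chySolutions c p q r, (chyJacobian c p q r u).det ≠ 0

/-- The matrix with entries `2 p_a · p_b / |a b|` off the diagonal and `0` on it. -/
def aMatrix (G : Matrix ι ι ℂ) (u : ι → ℂ × ℂ) : Matrix ι ι ℂ := fun a b =>
  if a = b then 0 else G a b / bracket u a b

/-- Determinant of the submatrix obtained by removing the rows and columns in `β`. -/
def detRemove (M : Matrix ι ι ℂ) (β : Finset ι) : ℂ :=
  (M.submatrix (Subtype.val : {x : ι // x ∉ β} → ι) Subtype.val).det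

/-- The reduced determinant, with rows and columns `a`, `b` removed. -/
def reducedDet (G : Matrix ι ι ℂ) (u : ι → ℂ × ℂ) (a b : ι) : ℂ :=
  detRemove (aMatrix G u) {a, b} / bracket u a b ^ 2

/-- The Faddeev-Popov factor `|p q| |q r| |r p|`. -/
def faddeevPopov (u : ι → ℂ × ℂ) (p q r : ι) : ℂ :=
  bracket u p q * bracket u q r * bracket u r p

/-- The Parke-Taylor factor of a cyclically ordered list of legs. -/
def parkeTaylor (u : ι → ℂ × ℂ) (β : List ι) : ℂ :=
  ((β.zip (β.rotate 1)).map fun e => (bracket u e.1 e.2)⁻¹).prod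

/-- The special Galileon amplitude with massless Mandelstam invariants `s`, computed with the
punctures of `p, q, r` fixed and with rows and columns `a, b` removed. -/
def sGalAmplitude (s : Matrix ι ι ℂ) (p q r a b : ι) : ℂ :=
  chyIntegral s p q r fun u => (faddeevPopov u p q r * reducedDet s u a b) ^ 2

/-- Coefficients of the logarithms in the CHY potential when the legs `p, q, r` may be off-shell.
Here `G a b = 2 p_a · p_b`, so that `G a a / 2` is the square of the momentum of leg `a`. -/
def naculichCoeff (G : Matrix ι ι ℂ) (p q r : ι) : Matrix ι ι ℂ := fun a b =>
  G a b +
    if (a = p ∧ b = q) ∨ (a = q ∧ b = p) then (G p p + G q q - G r r) / 2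
    else if (a = r ∧ b = p) ∨ (a = p ∧ b = r) then (G r r + G p p - G q q) / 2
    else if (a = q ∧ b = r) ∨ (a = r ∧ b = q) then (G q q + G r r - G p p) / 2
    else 0

/-- The special Galileon amputated current with off-shell leg `r`. Its reduced determinant removes
the off-shell leg `r` and the fixed on-shell leg `p`, so that no entry of the matrix involves the
off-shell leg. -/
def sGalCurrent (G : Matrix ι ι ℂ) (p q r : ι) : ℂ :=
  chyIntegral (naculichCoeff G p q r) p q r fun u =>
    (faddeevPopov u p q r * reducedDet G u p r) ^ 2

/-- The amputated current of special Galileons and biadjoint scalars, the latter being the legs in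
the ordered list `β`, with the off-shell leg among `p, q, r`. -/
def sGalMixedCurrent (G : Matrix ι ι ℂ) (p q r : ι) (β : List ι) : ℂ :=
  chyIntegral (naculichCoeff G p q r) p q r fun u =>
    (faddeevPopov u p q r * parkeTaylor u β * detRemove (aMatrix G u) β.toFinset) ^ 2

end CHY

/-- The particle labels `1, …, n`. -/
abbrev Particle (n : ℕ) : Type := ↥(Finset.Icc 1 n)

variable {n : ℕ}

/-- Matrices of Mandelstam invariants of `n` massless particles with momentum conservation. -/
structure IsMandelstam (s : Matrix (Particle n) (Particle n) ℂ) : Prop where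
  symm : ∀ a b, s a b = s b a
  massless : ∀ a, s a a = 0
  conservation : ∀ a, ∑ b, s a b = 0

/-- `a < b < c` up to cyclic rotation. -/
def CycLt (a b c : Particle n) : Prop :=
  (a < b ∧ b < c) ∨ (b < c ∧ c < a) ∨ (c < a ∧ a < b)

instance (a b c : Particle n) : Decidable (CycLt a b c) := by
  unfold CycLt; infer_instance

/-- The pair `{a, b}` interlaces the triple `i < j < k`: the two labels lie in different ones of the
three open cyclic intervals cut out by `i, j, k`. -/
def Interlaces (i j k a b : Particle n) : Prop :=
  ((CycLt k a i ∧ CycLt i b j) ∨ (CycLt i a j ∧ CycLt j b k) ∨ (CycLt j a k ∧ CycLt k b i)) ∨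
  ((CycLt k b i ∧ CycLt i a j) ∨ (CycLt i b j ∧ CycLt j a k) ∨ (CycLt j b k ∧ CycLt k a i))

/-- The `(i, j, k)` split kinematics subspace. -/
def IsSplit (i j k : Particle n) (s : Matrix (Particle n) (Particle n) ℂ) : Prop :=
  ∀ a b, Interlaces i j k a b → s a b = 0

/-- Genericity on the split subspace, where the scattering equations no longer keep apart the
punctures of pairs that interlace the triple: in the gauge where `i, j, k` sit at `0, 1, ∞`, no
solution has two coinciding punctures that belong to such a pair. -/
def NoCollision (i j k : Particle n) (s : Matrix (Particle n) (Particle n) ℂ) : Prop :=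
  ∀ u : Particle n → ℂ × ℂ, GaugeFixed i j k u →
    (∀ a b, a ≠ b → ¬ Interlaces i j k a b → bracket u a b ≠ 0) →
    (∀ a, a ≠ i → a ≠ j → a ≠ k → scatteringFn s u a = 0) →
    ∀ a b, Interlaces i j k a b → bracket u a b ≠ 0

/-- The closed cyclic interval from `x` to `y`. -/
def block (x y : Particle n) : Finset (Particle n) :=
  univ.filter fun a => a = x ∨ a = y ∨ CycLt x a y

/-- The initial point of a closed cyclic interval, as an element of it. -/
def blockFst (x y : Particle n) : ↥(block x y) := ⟨x, by simp [block]⟩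

/-- The final point of a closed cyclic interval, as an element of it. -/
def blockSnd (x y : Particle n) : ↥(block x y) := ⟨y, by simp [block]⟩

/-- The products `2 p_a · p_b` for the legs consisting of the particles in `T` and one further,
off-shell leg `none`, whose momentum is minus the sum of the momenta of the particles in `T`. -/
def offShellGram (s : Matrix (Particle n) (Particle n) ℂ) (T : Finset (Particle n)) :
    Matrix (Option ↥T) (Option ↥T) ℂ
  | some a, some b => s a b
  | some a, none => -∑ b ∈ T, s a b
  | none, some b => -∑ a ∈ T, s a b
  | none, none => ∑ a ∈ T, ∑ b ∈ T, s a b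

/-- The square of the total momentum of the particles in `S`, i.e. the inverse propagator of the
corresponding channel. -/
def channel (s : Matrix (Particle n) (Particle n) ℂ) (S : Finset (Particle n)) : ℂ :=
  ∑ a ∈ S, ∑ b ∈ S with a < b, s a b

/-- The special Galileon current with on-shell legs `i, …, j` and off-shell leg `K`, in the gauge
where `i, j, K` sit at `0, 1, ∞`. -/
def currentIJ (s : Matrix (Particle n) (Particle n) ℂ) (i j : Particle n) : ℂ :=
  sGalCurrent (offShellGram s (block i j)) (some (blockFst i j)) (some (blockSnd i j)) none

/-- The mixed current with on-shell legs `j, …, k` and off-shell leg `I`, biadjoint legs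
`I, j, k`, in the gauge where `I, j, k` sit at `0, 1, ∞`. -/
def currentJK (s : Matrix (Particle n) (Particle n) ℂ) (j k : Particle n) : ℂ :=
  sGalMixedCurrent (offShellGram s (block j k)) none (some (blockFst j k)) (some (blockSnd j k))
    [none, some (blockFst j k), some (blockSnd j k)]

/-- The mixed current with on-shell legs `k, …, n, 1, …, i` and off-shell leg `J`, biadjoint legs
`i, J, k`, in the gauge where `i, J, k` sit at `0, 1, ∞`. -/
def currentKI (s : Matrix (Particle n) (Particle n) ℂ) (k i : Particle n) : ℂ :=
  sGalMixedCurrent (offShellGram s (block k i)) (some (blockSnd k i)) none (some (blockFst k i))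
    [some (blockSnd k i), none, some (blockFst k i)]

/-- The delta functions in the three currents are honest. -/
def CurrentsRegular (i j k : Particle n) (s : Matrix (Particle n) (Particle n) ℂ) : Prop :=
  CHYRegular (naculichCoeff (offShellGram s (block i j))
      (some (blockFst i j)) (some (blockSnd i j)) none)
    (some (blockFst i j)) (some (blockSnd i j)) none ∧
  CHYRegular (naculichCoeff (offShellGram s (block j k))
      none (some (blockFst j k)) (some (blockSnd j k)))
    none (some (blockFst j k)) (some (blockSnd j k)) ∧
  CHYRegular (naculichCoeff (offShellGram s (block k i))
      (some (blockSnd k i)) none (some (blockFst k i)))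
    (some (blockSnd k i)) none (some (blockFst k i))

end Split

end

set_option linter.unusedSectionVars false

open Finset

noncomputable section

/-! On the split subspace, in the gauge `(σ_i, σ_j, σ_k) = (0, 1, ∞)`, the puncture of a leg
interacts only with the three fixed punctures and with its own chamber. By momentum conservation,
the coupling of a chamber leg to the third fixed particle is its coupling to the off-shell leg of
the current (`offShellGram_eq`). The off-shell corrections to the potential concern only pairs of
fixed legs. So the scattering equations decouple into those of the three currents, and the Hessian
is block diagonal. Restriction to the chambers is an injection from solutions to triples of
solutions, which already gives the regularity claim. Genericity excludes collisions between
different chambers, so the injection becomes a bijection and the sum over solutions factorizes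
(`IsSplitting.chyIntegral`).

For the integrand, rows and columns `i` and `k` are removed. The remaining matrix consists of three
mutually decoupled chamber blocks joined only through leg `j`. When `j` is odd, the chamber between
`1` and `j` has odd size, so its antisymmetric minor vanishes. Expanding row `j` then leaves a
single product: `j` joins the first chamber and the other two split off (`blockDet_insert_union`,
`detRemove_aMatrix_split`). If `k` is odd too, the minor of the second chamber vanishes, and the
amplitude with it.

Any other gauge and choice of removed legs is reduced to this one. On solutions, the matrix `A` and
the Hessian have explicit null vectors, which fix how their principal minors depend on the removed
legs (`sq_mul_blockDet_erase`). Under projective transformations the squared reduced determinant and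
the reduced Jacobian have equal weights, which cancel (`sGalAmplitude_eq`). -/

namespace Split

/-! ### Principal minors: block factorization, parity, and null vectors. -/

section LinearAlgebra

variable {ι : Type*} [DecidableEq ι]

/-- The principal minor of `M` with rows and columns in `S`. -/
def blockDet (M : Matrix ι ι ℂ) (S : Finset ι) : ℂ :=
  (M.submatrix (Subtype.val : {x : ι // x ∈ S} → ι) Subtype.val).det

/-- A principal minor depends only on the set of indices, not on the type that enumerates it. This
brings determinants over different leg types to minors of one matrix. -/
theorem det_submatrix_eq_blockDet {α : Type*} [Fintype α] [DecidableEq α] (M : Matrix ι ι ℂ)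
    (S : Finset ι) (f : α → ι) (hf : Function.Injective f) (hS : ∀ x, x ∈ S ↔ ∃ a, f a = x) :
    (M.submatrix f f).det = blockDet M S := by
  let e : α ≃ {x : ι // x ∈ S} := Equiv.ofBijective (fun a => ⟨f a, (hS _).2 ⟨a, rfl⟩⟩)
    ⟨fun a b h => hf (congrArg Subtype.val h), fun ⟨x, hx⟩ => by
      obtain ⟨a, rfl⟩ := (hS x).1 hx
      exact ⟨a, rfl⟩⟩
  unfold blockDet
  rw [← Matrix.det_submatrix_equiv_self e]
  rfl

theorem blockDet_congr {M N : Matrix ι ι ℂ} {S : Finset ι}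
    (h : ∀ a ∈ S, ∀ b ∈ S, M a b = N a b) : blockDet M S = blockDet N S := by
  unfold blockDet
  congr 1
  ext a b
  exact h a a.2 b b.2

theorem blockDet_union (M : Matrix ι ι ℂ) {S T : Finset ι} (hST : Disjoint S T)
    (h : ∀ a ∈ T, ∀ b ∈ S, M a b = 0) :
    blockDet M (S ∪ T) = blockDet M S * blockDet M T := by
  rw [← det_submatrix_eq_blockDet M (S ∪ T)
    (Sum.elim Subtype.val Subtype.val : {x // x ∈ S} ⊕ {x // x ∈ T} → ι)]
  · unfold blockDet
    rw [← Matrix.det_fromBlocks_zero₂₁ _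
      (M.submatrix (Subtype.val : {x : ι // x ∈ S} → ι) (Subtype.val : {x : ι // x ∈ T} → ι)) _]
    congr 1
    ext (a | a) (b | b)
    · rfl
    · rfl
    · exact h a a.2 b b.2
    · rfl
  · rintro (a | a) (b | b) hab
    · exact congrArg Sum.inl (Subtype.ext hab)
    · have : (a : ι) = b := hab
      exact absurd (this ▸ a.2) (Finset.disjoint_right.1 hST b.2)
    · have : (a : ι) = b := hab
      exact absurd a.2 (Finset.disjoint_left.1 hST (this ▸ b.2))
    · exact congrArg Sum.inr (Subtype.ext hab)
  · intro x
    simp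

theorem blockDet_update_add (M : Matrix ι ι ℂ) {S : Finset ι} {j : ι} (hj : j ∈ S)
    (v w : ι → ℂ) (h : ∀ b ∈ S, M j b = v b + w b) :
    blockDet M S = blockDet (M.updateRow j v) S + blockDet (M.updateRow j w) S := by
  have key : ∀ r : ι → ℂ, blockDet (M.updateRow j r) S =
      ((M.submatrix (Subtype.val : {x : ι // x ∈ S} → ι) Subtype.val).updateRow ⟨j, hj⟩
        fun b => r b).det := by
    intro r
    unfold blockDet
    congr 1
    ext a b
    by_cases hab : a = ⟨j, hj⟩
    · subst hab
      simp
    · have hab' : (a : ι) ≠ j := fun h => hab (Subtype.ext h)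
      simp [Matrix.updateRow_ne hab, Matrix.updateRow_ne hab']
  rw [key, key, ← Matrix.det_updateRow_add]
  unfold blockDet
  congr 1
  ext a b
  by_cases hab : a = ⟨j, hj⟩
  · subst hab
    simpa using h b b.2
  · simp [Matrix.updateRow_ne hab]

/-- If `S` and `T` are coupled only through `j` and the minor of `S` vanishes, then `T` splits
off. -/
theorem blockDet_insert_union (M : Matrix ι ι ℂ) {S T : Finset ι} {j : ι} (hST : Disjoint S T)
    (hjS : j ∉ S) (hjT : j ∉ T) (h₁ : ∀ a ∈ S, ∀ b ∈ T, M a b = 0)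
    (h₂ : ∀ a ∈ T, ∀ b ∈ S, M a b = 0) (h₀ : blockDet M S = 0) :
    blockDet M (insert j S ∪ T) = blockDet M (insert j S) * blockDet M T := by
  have hd : Disjoint T (insert j S) := by
    rw [Finset.disjoint_insert_right]
    exact ⟨hjT, hST.symm⟩
  have hd' : Disjoint S (insert j T) := by
    rw [Finset.disjoint_insert_right]
    exact ⟨hjS, hST⟩
  rw [blockDet_update_add M (j := j) (by simp) (fun b => if b ∈ T then 0 else M j b)
    (fun b => if b ∈ T then M j b else 0) (by intro b _; split_ifs <;> simp)]
  -- Row `j` is split into its entries off `T` and on `T`. For the first part no row of `insert j S`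
  -- reaches `T`, so the matrix is block triangular even though column `j` may still couple to `T`.
  have e1 : blockDet (M.updateRow j fun b => if b ∈ T then 0 else M j b) (insert j S ∪ T) =
      blockDet M (insert j S) * blockDet M T := by
    rw [Finset.union_comm, blockDet_union _ hd, mul_comm]
    · congr 1
      · apply blockDet_congr
        intro a ha b hb
        by_cases haj : a = j
        · subst haj
          simp [Finset.disjoint_right.1 hd hb]
        · rw [Matrix.updateRow_ne haj]
      · apply blockDet_congr
        intro a ha b hb
        rw [Matrix.updateRow_ne (ne_of_mem_of_not_mem ha hjT)]
    · intro a ha b hb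
      by_cases haj : a = j
      · subst haj
        simp [hb]
      · rw [Matrix.updateRow_ne haj]
        exact h₁ a (Finset.mem_of_mem_insert_of_ne ha haj) b hb
  -- For the second part row `j` no longer reaches `S`; `j` can be grouped with `T`, and the
  -- vanishing minor of `S` becomes a factor.
  have e2 : blockDet (M.updateRow j fun b => if b ∈ T then M j b else 0) (insert j S ∪ T) = 0 := by
    have : insert j S ∪ T = S ∪ insert j T := by ext; simp
    rw [this, blockDet_union _ hd']
    · have : blockDet (M.updateRow j fun b => if b ∈ T then M j b else 0) S = blockDet M S := by
        apply blockDet_congr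
        intro a ha b hb
        rw [Matrix.updateRow_ne (ne_of_mem_of_not_mem ha hjS)]
      rw [this, h₀, zero_mul]
    · intro a ha b hb
      by_cases haj : a = j
      · subst haj
        simp [Finset.disjoint_left.1 hST hb]
      · rw [Matrix.updateRow_ne haj]
        exact h₂ a (Finset.mem_of_mem_insert_of_ne ha haj) b hb
  rw [e1, e2, add_zero]

/-- The matrix `M` with its rows and columns rescaled by `v`. -/
def scaleBoth (v : ι → ℂ) (M : Matrix ι ι ℂ) : Matrix ι ι ℂ := fun a b => v a * v b * M a b

theorem blockDet_scaleBoth (M : Matrix ι ι ℂ) (v : ι → ℂ) (S : Finset ι) :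
    blockDet (scaleBoth v M) S = (∏ a ∈ S, v a) ^ 2 * blockDet M S := by
  have h := Matrix.det_mul_row (fun a : {x : ι // x ∈ S} => v a)
    (fun a b => v a * (M.submatrix Subtype.val Subtype.val) a b)
  have h' := Matrix.det_mul_column (fun a : {x : ι // x ∈ S} => v a)
    (M.submatrix Subtype.val Subtype.val)
  rw [← Finset.prod_coe_sort S v, pow_two, mul_assoc]
  unfold blockDet
  erw [← h', ← h]
  congr 1
  ext a b
  change v a * v b * M a b = v b * (v a * M a b)
  ring

theorem blockDet_eq_zero_of_odd (M : Matrix ι ι ℂ) {S : Finset ι} (hM : ∀ a b, M b a = -M a b)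
    (hS : Odd S.card) : blockDet M S = 0 := by
  have h : blockDet M S = -blockDet M S := by
    conv_lhs => rw [blockDet, ← Matrix.det_transpose]
    have : (M.submatrix (Subtype.val : {x : ι // x ∈ S} → ι) Subtype.val).transpose =
        -(M.submatrix (Subtype.val : {x : ι // x ∈ S} → ι) Subtype.val) := by
      ext a b
      simp [hM b.1 a.1]
    rw [this, Matrix.det_neg, Fintype.card_coe, hS.neg_one_pow, neg_one_mul, blockDet]
  exact self_eq_neg.1 h

/-- Put `w` in column `b` and the zero vector `N z` in column `c`, then expand column `c` as a
combination of the columns of `N`. Only the terms `f = b` and `f = c` avoid a repeated column. No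
assumption on the rank of `N` is needed. -/
theorem cramer_mul_eq {α : Type*} [Fintype α] [DecidableEq α] (N : Matrix α α ℂ) (z w : α → ℂ)
    (hz : N.mulVec z = 0) (b c : α) : z c * N.cramer w b = z b * N.cramer w c := by
  rcases eq_or_ne b c with rfl | hbc
  · rfl
  have h0 : ((N.updateCol b w).updateCol c (N.mulVec z)).det = 0 := by
    rw [hz]
    exact Matrix.det_eq_zero_of_column_eq_zero c (by simp)
  have h1 : N.mulVec z = fun i => ∑ f, z f * N i f := by
    ext i
    simp [Matrix.mulVec, dotProduct, mul_comm]
  have h2 : ((N.updateCol b w).updateCol c (N.mulVec z)).det =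
      ∑ f, z f * ((N.updateCol b w).updateCol c (fun i => N i f)).det := by
    have := map_sum (N.updateCol b w).cramer (fun f => z f • (fun i => N i f)) univ
    have h3 := congrFun this c
    simp only [map_smul, Finset.sum_apply, Pi.smul_apply, Matrix.cramer_apply, smul_eq_mul] at h3
    rw [← h3]
    congr 2
    rw [h1]
    ext i
    simp
  rw [h2, Finset.sum_eq_add b c hbc] at h0
  · have e1 : ((N.updateCol b w).updateCol c (fun i => N i c)).det = N.cramer w b := by
      rw [Matrix.cramer_apply]
      congr 1
      ext x y
      by_cases hy : y = c
      · subst hy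
        simp [Matrix.updateCol_ne hbc.symm]
      · rw [Matrix.updateCol_ne hy]
    -- Columns `b` and `c` are exchanged relative to `N.updateCol c w`, hence the sign.
    have e2 : ((N.updateCol b w).updateCol c (fun i => N i b)).det = -N.cramer w c := by
      have := Matrix.det_permute' (Equiv.swap b c) (N.updateCol c w)
      rw [Equiv.Perm.sign_swap hbc] at this
      rw [Matrix.cramer_apply]
      trans ((N.updateCol c w).submatrix id (Equiv.swap b c)).det
      · congr 1
        ext x y
        by_cases hc : y = c
        · subst hc
          simp [Matrix.updateCol_ne hbc]
        · by_cases hb : y = b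
          · subst hb
            simp [Matrix.updateCol_ne hc]
          · simp [Matrix.updateCol_ne hc, Matrix.updateCol_ne hb,
              Equiv.swap_apply_of_ne_of_ne hb hc]
      · simpa using this
    rw [e1, e2] at h0
    linear_combination h0
  · intro f _ hf
    rw [Matrix.det_zero_of_column_eq (i := f) (j := c) hf.2, mul_zero]
    intro i
    simp [Matrix.updateCol_ne hf.2, Matrix.updateCol_ne hf.1]
  · simp
  · simp

theorem adjugate_self_eq_blockDet {α : Type*} [Fintype α] [DecidableEq α] (N : Matrix α α ℂ)
    (b : α) : N.adjugate b b = blockDet N (univ.erase b) := by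
  have h : (N.updateRow b (Pi.single b 1)).det =
      blockDet (N.updateRow b (Pi.single b 1)) (univ.erase b ∪ {b}) := by
    rw [← det_submatrix_eq_blockDet _ _ id Function.injective_id, Matrix.submatrix_id_id]
    intro x
    by_cases hx : x = b <;> simp [hx]
  rw [Matrix.adjugate_apply, h, blockDet_union]
  · have h1 : blockDet (N.updateRow b (Pi.single b 1)) {b} = 1 := by
      rw [← det_submatrix_eq_blockDet _ _ (fun _ : Unit => b) (fun _ _ _ => rfl)]
      · simp [Matrix.det_unique]
      · simp [eq_comm]
    rw [h1, mul_one]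
    apply blockDet_congr
    intro a ha c _
    rw [Matrix.updateRow_ne (Finset.ne_of_mem_erase ha)]
  · simp
  · intro a ha c hc
    rw [Finset.mem_singleton] at ha
    subst ha
    simp [Finset.ne_of_mem_erase hc]

/-- The principal minors of a matrix with a common left and right null vector `z` are
proportional to the squares of the entries of `z`. -/
theorem sq_mul_blockDet_erase (M : Matrix ι ι ℂ) (U : Finset ι) (z : ι → ℂ)
    (h₁ : ∀ a ∈ U, ∑ x ∈ U, M a x * z x = 0) (h₂ : ∀ a ∈ U, ∑ x ∈ U, M x a * z x = 0)
    {b c : ι} (hb : b ∈ U) (hc : c ∈ U) :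
    z c ^ 2 * blockDet M (U.erase b) = z b ^ 2 * blockDet M (U.erase c) := by
  let N : Matrix {x // x ∈ U} {x // x ∈ U} ℂ := M.submatrix Subtype.val Subtype.val
  let z' : {x // x ∈ U} → ℂ := fun x => z x
  have hN : N.mulVec z' = 0 := by
    ext a
    refine Eq.trans ?_ (h₁ a a.2)
    rw [← Finset.sum_coe_sort]
    rfl
  have hNt : N.transpose.mulVec z' = 0 := by
    ext a
    refine Eq.trans ?_ (h₂ a a.2)
    rw [← Finset.sum_coe_sort]
    rfl
  have key : ∀ (d : ι) (hd : d ∈ U), N.adjugate ⟨d, hd⟩ ⟨d, hd⟩ = blockDet M (U.erase d) := by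
    intro d hd
    rw [adjugate_self_eq_blockDet]
    unfold blockDet N
    rw [Matrix.submatrix_submatrix, det_submatrix_eq_blockDet M (U.erase d)]
    · rfl
    · exact Subtype.val_injective.comp Subtype.val_injective
    · intro x
      constructor
      · intro hx
        exact ⟨⟨⟨x, Finset.mem_of_mem_erase hx⟩, by simpa using Finset.ne_of_mem_erase hx⟩, rfl⟩
      · rintro ⟨⟨⟨y, hy⟩, hy'⟩, rfl⟩
        simpa [hy] using hy'
  have hadj : ∀ d e, N.adjugate d e = N.cramer (Pi.single e 1) d := fun d e => by
    rw [← Matrix.transpose_apply (N.adjugate), Matrix.adjugate_transpose, Matrix.adjugate_def,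
      Matrix.of_apply, Matrix.transpose_transpose]
  have hadjt : ∀ d e, N.adjugate d e = N.transpose.cramer (Pi.single d 1) e := fun d e => by
    rw [Matrix.adjugate_def, Matrix.of_apply]
  rw [← key b hb, ← key c hc]
  -- The right null vector compares two adjugate entries in column `b`, the left one two entries in
  -- row `c`. The shared entry at `(c, b)` links the two diagonal entries.
  have e1 := cramer_mul_eq N z' (Pi.single ⟨b, hb⟩ 1) hN ⟨b, hb⟩ ⟨c, hc⟩
  have e2 := cramer_mul_eq N.transpose z' (Pi.single ⟨c, hc⟩ 1) hNt ⟨b, hb⟩ ⟨c, hc⟩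
  rw [← hadj, ← hadj] at e1
  rw [← hadjt, ← hadjt] at e2
  change z c * _ = z b * _ at e1
  change z c * _ = z b * _ at e2
  linear_combination z c * e1 + z b * e2

end LinearAlgebra

/-! ### Independence of the removed legs on solutions of the scattering equations. -/

section GaugeIndependence

variable {ι : Type} [Fintype ι] [DecidableEq ι]

theorem detRemove_eq_blockDet (M : Matrix ι ι ℂ) (β : Finset ι) :
    detRemove M β = blockDet M βᶜ :=
  det_submatrix_eq_blockDet M _ _ Subtype.val_injective (by simp)

theorem bracket_self (u : ι → ℂ × ℂ) (a : ι) : bracket u a a = 0 := by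
  unfold bracket; ring

theorem bracket_swap (u : ι → ℂ × ℂ) (a b : ι) : bracket u b a = -bracket u a b := by
  unfold bracket; ring

/-- Momentum conservation on the support of the scattering equations, at every leg and
independently of the gauge. -/
def OnShell (s : Matrix ι ι ℂ) (u : ι → ℂ × ℂ) : Prop :=
  ∀ a c, ∑ b, aMatrix s u a b * bracket u b c = 0

theorem aMatrix_swap {s : Matrix ι ι ℂ} (hs : ∀ a b, s a b = s b a) (u : ι → ℂ × ℂ) (a b : ι) :
    aMatrix s u b a = -aMatrix s u a b := by
  unfold aMatrix
  by_cases h : a = b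
  · simp [h]
  · rw [if_neg h, if_neg (Ne.symm h), bracket_swap u a b, hs b a, div_neg]

theorem sum_aMatrix_mul (s : Matrix ι ι ℂ) (u : ι → ℂ × ℂ) (a : ι) (f : ι → ℂ) :
    ∑ b, aMatrix s u a b * f b = ∑ b ∈ univ.erase a, s a b * f b / bracket u a b := by
  rw [← Finset.add_sum_erase _ _ (Finset.mem_univ a)]
  simp only [aMatrix, if_true, zero_mul, zero_add]
  apply Finset.sum_congr rfl
  intro b hb
  rw [if_neg (Finset.ne_of_mem_erase hb).symm]
  ring

theorem scatteringFn_eq_sum (s : Matrix ι ι ℂ) (u : ι → ℂ × ℂ) (a : ι) :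
    scatteringFn s u a = ∑ b, aMatrix s u a b * (u b).2 := by
  rw [sum_aMatrix_mul]; rfl

theorem sum_antisymm_eq_zero (f : ι → ι → ℂ) (hf : ∀ a b, f b a = -f a b) :
    ∑ a, ∑ b, f a b = 0 := by
  have h : ∑ a, ∑ b, f a b = -∑ a, ∑ b, f a b := by
    conv_lhs => rw [Finset.sum_comm]
    simp only [← Finset.sum_neg_distrib]
    exact Finset.sum_congr rfl fun a _ => Finset.sum_congr rfl fun b _ => hf a b
  exact self_eq_neg.1 h

theorem sum_aMatrix_mul_bracket {s : Matrix ι ι ℂ} (hs0 : ∀ a, s a a = 0)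
    (hs1 : ∀ a, ∑ b, s a b = 0) {u : ι → ℂ × ℂ} (hne : ∀ a b, a ≠ b → bracket u a b ≠ 0) (a : ι) :
    ∑ b, aMatrix s u a b * bracket u a b = 0 := by
  rw [← hs1 a]
  apply Finset.sum_congr rfl
  intro b _
  unfold aMatrix
  by_cases h : a = b
  · subst h; simp [hs0]
  · rw [if_neg h, div_mul_cancel₀ _ (hne a b h)]

theorem GaugeFixed.ne {p q r : ι} {u : ι → ℂ × ℂ} (hu : GaugeFixed p q r u) :
    p ≠ q ∧ q ≠ r ∧ r ≠ p := by
  refine ⟨?_, ?_, ?_⟩ <;> rintro rfl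
  · simpa using congrArg Prod.fst (hu.zero.symm.trans hu.one)
  · simpa using congrArg Prod.snd (hu.one.symm.trans hu.infty)
  · simpa using congrArg Prod.fst (hu.zero.symm.trans hu.infty)

/-- The equations of the three fixed legs follow from the others by projective invariance.
Conservation at each fixed leg and three antisymmetric double sums give six linear equations for the
six unknowns `X`, `Y` at `p`, `q`, `r`; with punctures `0, 1, ∞` their only solution is zero. -/
theorem onShell_of_mem_chySolutions {s : Matrix ι ι ℂ} (hs : ∀ a b, s a b = s b a)
    (hs0 : ∀ a, s a a = 0) (hs1 : ∀ a, ∑ b, s a b = 0) {p q r : ι} {u : ι → ℂ × ℂ}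
    (hu : u ∈ chySolutions s p q r) : OnShell s u := by
  obtain ⟨hg, hne, hsc⟩ := hu
  obtain ⟨hpq, hqr, hrp⟩ := hg.ne
  set X : ι → ℂ := fun a => ∑ b, aMatrix s u a b * (u b).1 with hX
  set Y : ι → ℂ := fun a => ∑ b, aMatrix s u a b * (u b).2 with hY
  have hXY : ∀ a, (u a).1 * Y a - (u a).2 * X a = 0 := by
    intro a
    rw [← sum_aMatrix_mul_bracket hs0 hs1 hne a]
    simp only [hX, hY, Finset.mul_sum, ← Finset.sum_sub_distrib, bracket]
    exact Finset.sum_congr rfl fun b _ => by ring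
  have hYf : ∀ a, a ≠ p → a ≠ q → a ≠ r → Y a = 0 := fun a h1 h2 h3 => by
    rw [hY, ← hsc a h1 h2 h3, scatteringFn_eq_sum]
  have hXf : ∀ a, a ≠ p → a ≠ q → a ≠ r → X a = 0 := fun a h1 h2 h3 => by
    have := hXY a
    rw [hYf a h1 h2 h3, hg.affine a h1 h2 h3] at this
    simpa using this
  have three : ∀ f : ι → ℂ, (∀ a, a ≠ p → a ≠ q → a ≠ r → f a = 0) →
      ∑ a, f a = f p + f q + f r := by
    intro f hf
    rw [← Finset.sum_subset (Finset.subset_univ {p, q, r})]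
    · rw [Finset.sum_insert (by simp [hpq, hrp.symm]), Finset.sum_insert (by simp [hqr]),
        Finset.sum_singleton, add_assoc]
    · intro x _ hx
      simp only [Finset.mem_insert, Finset.mem_singleton, not_or] at hx
      exact hf x hx.1 hx.2.1 hx.2.2
  have hyy : ∑ a, (u a).2 * Y a = 0 := by
    simp only [hY, Finset.mul_sum]
    apply sum_antisymm_eq_zero
    intro a b
    rw [aMatrix_swap hs u a b]; ring
  have hxx : ∑ a, (u a).1 * X a = 0 := by
    simp only [hX, Finset.mul_sum]
    apply sum_antisymm_eq_zero
    intro a b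
    rw [aMatrix_swap hs u a b]; ring
  have hxy : ∑ a, ((u a).1 * Y a + (u a).2 * X a) = 0 := by
    simp only [hX, hY, Finset.mul_sum, ← Finset.sum_add_distrib]
    apply sum_antisymm_eq_zero
    intro a b
    rw [aMatrix_swap hs u a b]; ring
  rw [three _ (fun a h1 h2 h3 => by rw [hYf a h1 h2 h3, mul_zero])] at hyy
  rw [three _ (fun a h1 h2 h3 => by rw [hXf a h1 h2 h3, mul_zero])] at hxx
  rw [three _ (fun a h1 h2 h3 => by rw [hXf a h1 h2 h3, hYf a h1 h2 h3]; ring)] at hxy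
  have h_p := hXY p
  have h_q := hXY q
  have h_r := hXY r
  rw [hg.zero, hg.one, hg.infty] at hyy hxx hxy
  rw [hg.zero] at h_p
  rw [hg.one] at h_q
  rw [hg.infty] at h_r
  simp only [zero_mul, one_mul, zero_add, add_zero, zero_sub, sub_zero] at hyy hxx hxy h_p h_q h_r
  have hX0 : ∀ a, X a = 0 := by
    intro a
    by_cases h1 : a = p
    · subst h1; linear_combination -h_p
    by_cases h2 : a = q
    · subst h2; linear_combination (1 / 2 : ℂ) * hxy - (1 / 2 : ℂ) * h_q + (1 / 2 : ℂ) * h_p - (1 / 2 : ℂ) * h_r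
    by_cases h3 : a = r
    · subst h3; linear_combination hxx - ((1 / 2 : ℂ) * hxy - (1 / 2 : ℂ) * h_q + (1 / 2 : ℂ) * h_p - (1 / 2 : ℂ) * h_r)
    exact hXf a h1 h2 h3
  have hY0 : ∀ a, Y a = 0 := by
    intro a
    have hq0 := hX0 q
    by_cases h1 : a = p
    · subst h1; linear_combination hyy - h_q - hq0
    by_cases h2 : a = q
    · subst h2; linear_combination h_q + hq0
    by_cases h3 : a = r
    · subst h3; linear_combination h_r
    exact hYf a h1 h2 h3
  intro a c
  have : ∑ b, aMatrix s u a b * bracket u b c = X a * (u c).2 - Y a * (u c).1 := by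
    simp only [hX, hY, Finset.sum_mul, ← Finset.sum_sub_distrib, bracket]
    exact Finset.sum_congr rfl fun b _ => by ring
  rw [this, hX0, hY0]
  ring

theorem scatteringFn_eq_zero_of_onShell {s : Matrix ι ι ℂ} {u : ι → ℂ × ℂ} (h : OnShell s u) {r : ι}
    (hr : u r = (1, 0)) (a : ι) : scatteringFn s u a = 0 := by
  have := h a r
  simp only [bracket, hr, mul_zero, one_mul, zero_sub, mul_neg, Finset.sum_neg_distrib] at this
  rw [scatteringFn_eq_sum]
  exact neg_eq_zero.1 this

theorem reducedDet_comm (s : Matrix ι ι ℂ) (u : ι → ℂ × ℂ) (a b : ι) :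
    reducedDet s u a b = reducedDet s u b a := by
  unfold reducedDet
  rw [Finset.pair_comm, bracket_swap u b a, neg_sq]

/-- On shell, `x ↦ |x b|` is a null vector of the antisymmetric matrix `A`. It vanishes at `b`, so
it remains one after row and column `b` are removed. -/
theorem reducedDet_replace {s : Matrix ι ι ℂ} (hs : ∀ a b, s a b = s b a) {u : ι → ℂ × ℂ}
    (hne : ∀ a b, a ≠ b → bracket u a b ≠ 0) (h : OnShell s u) {a b c : ι} (hab : a ≠ b)
    (hcb : c ≠ b) : reducedDet s u a b = reducedDet s u c b := by
  have hsum : ∀ x ∈ univ.erase b, ∑ y ∈ univ.erase b, aMatrix s u x y * bracket u y b = 0 := by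
    intro x _
    rw [Finset.sum_erase _ (by rw [bracket_self, mul_zero])]
    exact h x b
  have key := sq_mul_blockDet_erase (aMatrix s u) (univ.erase b) (fun x => bracket u x b) hsum
    (fun x hx => by
      rw [← neg_eq_zero, ← Finset.sum_neg_distrib, ← hsum x hx]
      exact Finset.sum_congr rfl fun y _ => by rw [aMatrix_swap hs u x y]; ring)
    (b := a) (c := c) (by simp [hab]) (by simp [hcb])
  have hset : ∀ x : ι, (univ.erase b).erase x = ({x, b} : Finset ι)ᶜ := by
    intro x; ext y; simp
  rw [hset, hset] at key
  unfold reducedDet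
  rw [detRemove_eq_blockDet, detRemove_eq_blockDet, div_eq_div_iff
    (pow_ne_zero 2 (hne a b hab)) (pow_ne_zero 2 (hne c b hcb))]
  linear_combination key

/-- On the support of the scattering equations the reduced determinant does not depend on the
removed legs. -/
theorem reducedDet_eq {s : Matrix ι ι ℂ} (hs : ∀ a b, s a b = s b a) {u : ι → ℂ × ℂ}
    (hne : ∀ a b, a ≠ b → bracket u a b ≠ 0) (h : OnShell s u) {a b c d : ι} (hab : a ≠ b)
    (hcd : c ≠ d) : reducedDet s u a b = reducedDet s u c d := by
  by_cases hcb : c = b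
  · subst hcb
    rw [reducedDet_comm s u c d, reducedDet_replace hs hne h hab hcd.symm]
  · rw [reducedDet_replace hs hne h hab hcb, reducedDet_comm s u c b, reducedDet_comm s u c d,
      reducedDet_replace hs hne h (Ne.symm hcb) hcd.symm]

/-- `Φ` is the Hessian of the CHY potential in homogeneous coordinates: its rows annihilate the
three quadratic forms in the punctures. -/
structure IsHessian (s : Matrix ι ι ℂ) (u : ι → ℂ × ℂ) (Φ : Matrix ι ι ℂ) : Prop where
  off_diag : ∀ a b, a ≠ b → Φ a b = s a b / bracket u a b ^ 2
  null : ∀ a c d, ∑ b, Φ a b * (bracket u b c * bracket u b d) = 0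

theorem IsHessian.symm {s : Matrix ι ι ℂ} (hs : ∀ a b, s a b = s b a) {u : ι → ℂ × ℂ}
    {Φ : Matrix ι ι ℂ} (hΦ : IsHessian s u Φ) (a b : ι) : Φ b a = Φ a b := by
  by_cases h : a = b
  · rw [h]
  · rw [hΦ.off_diag a b h, hΦ.off_diag b a (Ne.symm h), bracket_swap u a b, hs b a, neg_sq]

/-- The diagonal entry is chosen so that the null relation holds for `c = d = e a`, with `e a` an
auxiliary leg other than `a`. For general `c`, `d` the quadratic form expands around leg `a` into
three terms, which vanish by this choice, by the scattering equation and by momentum conservation.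
-/
theorem exists_isHessian {s : Matrix ι ι ℂ} (hs0 : ∀ a, s a a = 0) (hs1 : ∀ a, ∑ b, s a b = 0)
    {u : ι → ℂ × ℂ} (hne : ∀ a b, a ≠ b → bracket u a b ≠ 0) (h : OnShell s u) {p q : ι}
    (hpq : p ≠ q) : ∃ Φ, IsHessian s u Φ := by
  have hex : ∀ a, ∃ e, e ≠ a := fun a => by
    by_cases ha : p = a
    · exact ⟨q, fun h => hpq (ha.trans h.symm)⟩
    · exact ⟨p, ha⟩
  choose e he using hex
  refine ⟨fun a b => if a = b then
    -(∑ d ∈ univ.erase a, s a d * bracket u d (e a) ^ 2 / bracket u a d ^ 2) / bracket u a (e a) ^ 2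
    else s a b / bracket u a b ^ 2, fun a b hab => if_neg hab, fun a c d => ?_⟩
  have hae : bracket u a (e a) ≠ 0 := hne _ _ (he a).symm
  have hsh : ∑ b ∈ univ.erase a, s a b * bracket u b (e a) / bracket u a b = 0 := by
    rw [← sum_aMatrix_mul]; exact h a (e a)
  have hco : ∑ b ∈ univ.erase a, s a b = 0 := by
    rw [Finset.sum_erase _ (hs0 a), hs1 a]
  apply mul_left_cancel₀ (pow_ne_zero 2 hae)
  rw [← Finset.add_sum_erase _ _ (Finset.mem_univ a), if_pos rfl]
  have hsum : bracket u a (e a) ^ 2 * ∑ b ∈ univ.erase a,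
      (if a = b then
        -(∑ d ∈ univ.erase a, s a d * bracket u d (e a) ^ 2 / bracket u a d ^ 2) /
          bracket u a (e a) ^ 2
        else s a b / bracket u a b ^ 2) * (bracket u b c * bracket u b d) =
      (∑ b ∈ univ.erase a, s a b * bracket u b (e a) ^ 2 / bracket u a b ^ 2) *
        (bracket u a c * bracket u a d) +
      (∑ b ∈ univ.erase a, s a b * bracket u b (e a) / bracket u a b) *
        (bracket u a c * bracket u (e a) d + bracket u a d * bracket u (e a) c) +
      (∑ b ∈ univ.erase a, s a b) * (bracket u (e a) c * bracket u (e a) d) := by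
    rw [Finset.mul_sum, Finset.sum_mul, Finset.sum_mul, Finset.sum_mul, ← Finset.sum_add_distrib,
      ← Finset.sum_add_distrib]
    apply Finset.sum_congr rfl
    intro b hb
    have hab := (Finset.ne_of_mem_erase hb).symm
    have hab0 := hne a b hab
    rw [if_neg hab]
    -- The Plücker relation.
    have pl : ∀ c, bracket u b c * bracket u a (e a) =
        bracket u b (e a) * bracket u a c + bracket u a b * bracket u (e a) c := by
      intro c; unfold bracket; ring
    have : bracket u a (e a) ^ 2 * (s a b / bracket u a b ^ 2 * (bracket u b c * bracket u b d)) =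
        s a b / bracket u a b ^ 2 * ((bracket u b c * bracket u a (e a)) *
          (bracket u b d * bracket u a (e a))) := by ring
    rw [this, pl, pl]
    field_simp
    ring
  rw [mul_add, hsum, hsh, hco]
  field_simp
  ring

theorem faddeevPopov_rot (u : ι → ℂ × ℂ) (p q r : ι) :
    faddeevPopov u p q r = faddeevPopov u q r p := by
  unfold faddeevPopov; ring

theorem faddeevPopov_swap (u : ι → ℂ × ℂ) (p q r : ι) :
    faddeevPopov u p q r = -faddeevPopov u q p r := by
  unfold faddeevPopov bracket; ring

theorem faddeevPopov_ne_zero {u : ι → ℂ × ℂ} (hne : ∀ a b, a ≠ b → bracket u a b ≠ 0) {p q r : ι}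
    (hpq : p ≠ q) (hqr : q ≠ r) (hrp : r ≠ p) : faddeevPopov u p q r ≠ 0 :=
  mul_ne_zero (mul_ne_zero (hne _ _ hpq) (hne _ _ hqr)) (hne _ _ hrp)

/-- The reduced Jacobian, with rows and columns `p, q, r` removed. -/
def reducedJac (Φ : Matrix ι ι ℂ) (u : ι → ℂ × ℂ) (p q r : ι) : ℂ :=
  detRemove Φ {p, q, r} / faddeevPopov u p q r ^ 2

theorem reducedJac_rot (Φ : Matrix ι ι ℂ) (u : ι → ℂ × ℂ) (p q r : ι) :
    reducedJac Φ u p q r = reducedJac Φ u q r p := by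
  unfold reducedJac
  rw [faddeevPopov_rot, show ({p, q, r} : Finset ι) = {q, r, p} by ext; simp; tauto]

theorem reducedJac_swap (Φ : Matrix ι ι ℂ) (u : ι → ℂ × ℂ) (p q r : ι) :
    reducedJac Φ u p q r = reducedJac Φ u q p r := by
  unfold reducedJac
  rw [faddeevPopov_swap, neg_sq, show ({p, q, r} : Finset ι) = {q, p, r} by ext; simp; tauto]

/-- The null vector is `y ↦ |y q| |y r|`. It vanishes at `q` and `r`, so it survives the removal of
their rows and columns. -/
theorem IsHessian.reducedJac_replace {s : Matrix ι ι ℂ} (hs : ∀ a b, s a b = s b a)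
    {u : ι → ℂ × ℂ} (hne : ∀ a b, a ≠ b → bracket u a b ≠ 0) {Φ : Matrix ι ι ℂ}
    (hΦ : IsHessian s u Φ) {p p' q r : ι} (hpq : p ≠ q) (hqr : q ≠ r) (hrp : r ≠ p)
    (hpq' : p' ≠ q) (hrp' : r ≠ p') : reducedJac Φ u p q r = reducedJac Φ u p' q r := by
  have hsum : ∀ x ∈ ({q, r} : Finset ι)ᶜ, ∑ y ∈ ({q, r} : Finset ι)ᶜ,
      Φ x y * (bracket u y q * bracket u y r) = 0 := by
    intro x _
    rw [← hΦ.null x q r]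
    apply Finset.sum_subset (Finset.subset_univ _)
    intro y _ hy
    simp only [Finset.mem_compl, not_not, Finset.mem_insert, Finset.mem_singleton] at hy
    rcases hy with rfl | rfl <;> simp [bracket_self]
  have key := sq_mul_blockDet_erase Φ ({q, r} : Finset ι)ᶜ
    (fun y => bracket u y q * bracket u y r) hsum
    (fun x hx => by
      rw [← hsum x hx]
      exact Finset.sum_congr rfl fun y _ => by rw [hΦ.symm hs x y])
    (b := p) (c := p') (by simp [hpq, hrp.symm]) (by simp [hpq', hrp'.symm])
  have hset : ∀ x : ι, (({q, r} : Finset ι)ᶜ).erase x = ({x, q, r} : Finset ι)ᶜ := by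
    intro x; ext y; simp
  rw [hset, hset] at key
  unfold reducedJac
  rw [detRemove_eq_blockDet, detRemove_eq_blockDet, div_eq_div_iff
    (pow_ne_zero 2 (faddeevPopov_ne_zero hne hpq hqr hrp))
    (pow_ne_zero 2 (faddeevPopov_ne_zero hne hpq' hqr hrp'))]
  unfold faddeevPopov
  rw [bracket_swap u p r, bracket_swap u p' r]
  linear_combination bracket u q r ^ 2 * key

/-- On the support of the scattering equations the reduced Jacobian does not depend on the removed
legs. -/
theorem IsHessian.reducedJac_eq {s : Matrix ι ι ℂ} (hs : ∀ a b, s a b = s b a)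
    {u : ι → ℂ × ℂ} (hne : ∀ a b, a ≠ b → bracket u a b ≠ 0) {Φ : Matrix ι ι ℂ}
    (hΦ : IsHessian s u Φ) {p q r i j k : ι} (hpq : p ≠ q) (hqr : q ≠ r) (hrp : r ≠ p)
    (hij : i ≠ j) (hjk : j ≠ k) (hki : k ≠ i) :
    reducedJac Φ u p q r = reducedJac Φ u i j k := by
  have rep : ∀ {p p' q r : ι}, p ≠ q → q ≠ r → r ≠ p → p' ≠ q → r ≠ p' →
      reducedJac Φ u p q r = reducedJac Φ u p' q r :=
    fun h1 h2 h3 h4 h5 => hΦ.reducedJac_replace hs hne h1 h2 h3 h4 h5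
  -- The target legs are brought in one at a time; a leg that is already present is only permuted
  -- into place.
  have step1 : ∃ q' r', i ≠ q' ∧ q' ≠ r' ∧ r' ≠ i ∧
      reducedJac Φ u p q r = reducedJac Φ u i q' r' := by
    by_cases h1 : q = i
    · subst h1
      exact ⟨r, p, hqr, hrp, hpq, reducedJac_rot ..⟩
    by_cases h2 : r = i
    · subst h2
      exact ⟨p, q, hrp, hpq, hqr, by rw [reducedJac_rot, reducedJac_rot]⟩
    exact ⟨q, r, Ne.symm h1, hqr, h2, rep hpq hqr hrp (Ne.symm h1) h2⟩
  obtain ⟨q', r', h1, h2, h3, e1⟩ := step1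
  have step2 : ∃ r'', j ≠ r'' ∧ r'' ≠ i ∧ reducedJac Φ u i q' r' = reducedJac Φ u i j r'' := by
    by_cases h : r' = j
    · subst h
      refine ⟨q', h2.symm, h1.symm, ?_⟩
      rw [reducedJac_rot, reducedJac_swap, reducedJac_rot, reducedJac_rot]
    · refine ⟨r', Ne.symm h, h3, ?_⟩
      rw [reducedJac_rot, rep h2 h3 h1 (Ne.symm h) hij, reducedJac_rot, reducedJac_rot]
  obtain ⟨r'', h4, h5, e2⟩ := step2
  rw [e1, e2, reducedJac_rot, reducedJac_rot, rep h5 hij h4 hki hjk, reducedJac_rot]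

/-- In a gauge, the reduced Jacobian is the Jacobian determinant. -/
theorem IsHessian.det_chyJacobian {s : Matrix ι ι ℂ} {u : ι → ℂ × ℂ} {Φ : Matrix ι ι ℂ}
    (hΦ : IsHessian s u Φ) {p q r : ι} (hu : GaugeFixed p q r u) :
    (chyJacobian s p q r u).det = reducedJac Φ u p q r := by
  have h1 : faddeevPopov u p q r = 1 := by
    simp [faddeevPopov, bracket, hu.zero, hu.one, hu.infty]
  rw [reducedJac, h1, one_pow, div_one, detRemove_eq_blockDet,
    ← det_submatrix_eq_blockDet Φ _ (Subtype.val : Free p q r → ι) Subtype.val_injective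
      (by simp)]
  congr 1
  ext a b
  have ha := hu.affine a a.2.1 a.2.2.1 a.2.2.2
  unfold chyJacobian
  by_cases hab : a = b
  · subst hab
    rw [if_pos rfl, Matrix.submatrix_apply]
    have := hΦ.null a r r
    rw [← Finset.add_sum_erase _ _ (Finset.mem_univ (a : ι))] at this
    -- With `r` at infinity the null relation for `c = d = r` is the formula for the diagonal entry
    -- of the affine Hessian.
    have hr : ∀ b, bracket u b r * bracket u b r = (u b).2 ^ 2 := by
      intro b
      simp [bracket, hu.infty]
      ring
    simp only [hr, ha, one_pow, mul_one] at this
    rw [neg_eq_iff_add_eq_zero, add_comm, ← this]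
    congr 1
    apply Finset.sum_congr rfl
    intro d hd
    rw [hΦ.off_diag _ _ (Finset.ne_of_mem_erase hd).symm]
    ring
  · rw [if_neg hab, Matrix.submatrix_apply, hΦ.off_diag _ _ fun h => hab (Subtype.ext h)]

end GaugeIndependence

/-! ### Projective transformations and gauge independence of the amplitude. -/

section GaugeChange

variable {ι : Type} [Fintype ι] [DecidableEq ι]

/-- The punctures of `u'` arise from those of `u` by a projective transformation and a change of
homogeneous coordinates; up to normalization, the Pluecker coordinates change as stated. -/
structure IsRescaling (t : ι → ℂ) (u u' : ι → ℂ × ℂ) : Prop where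
  ne_zero : ∀ a, t a ≠ 0
  bracket : ∀ a b, bracket u' a b = t a * t b * bracket u a b

theorem IsRescaling.distinct {t : ι → ℂ} {u u' : ι → ℂ × ℂ} (h : IsRescaling t u u')
    (hne : ∀ a b, a ≠ b → Split.bracket u a b ≠ 0) (a b : ι) (hab : a ≠ b) :
    Split.bracket u' a b ≠ 0 := by
  rw [h.bracket]
  exact mul_ne_zero (mul_ne_zero (h.ne_zero a) (h.ne_zero b)) (hne a b hab)

theorem IsRescaling.aMatrix {t : ι → ℂ} {u u' : ι → ℂ × ℂ} (h : IsRescaling t u u')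
    (s : Matrix ι ι ℂ) :
    aMatrix s u' = scaleBoth (fun a => (t a)⁻¹) (aMatrix s u) := by
  ext a b
  unfold scaleBoth
  unfold Split.aMatrix
  by_cases hab : a = b
  · simp [hab]
  · rw [if_neg hab, if_neg hab, h.bracket]
    have := h.ne_zero a
    have := h.ne_zero b
    rw [div_eq_mul_inv, div_eq_mul_inv, mul_inv, mul_inv]
    ring

theorem IsRescaling.onShell {t : ι → ℂ} {u u' : ι → ℂ × ℂ} (h : IsRescaling t u u')
    {s : Matrix ι ι ℂ} (hs : OnShell s u) : OnShell s u' := by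
  intro a c
  rw [← mul_zero ((t a)⁻¹ * t c), ← hs a c, Finset.mul_sum, h.aMatrix]
  unfold scaleBoth
  apply Finset.sum_congr rfl
  intro b _
  have := h.ne_zero b
  rw [h.bracket]
  field_simp

theorem prod_compl_inv {t : ι → ℂ} (ht : ∀ a, t a ≠ 0) (S : Finset ι) :
    ∏ a ∈ Sᶜ, (t a)⁻¹ = (∏ a ∈ S, t a) / ∏ a, t a := by
  have h : ∏ a ∈ S, t a ≠ 0 := Finset.prod_ne_zero_iff.2 fun a _ => ht a
  have h' : ∏ a ∈ Sᶜ, t a ≠ 0 := Finset.prod_ne_zero_iff.2 fun a _ => ht a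
  rw [Finset.prod_inv_distrib, ← Finset.prod_mul_prod_compl S t]
  field_simp

/-- The minor scales with the weights of the kept legs and the denominator with those of the removed
ones; together they give the product over all legs, whichever legs are removed.
`IsRescaling.reducedJac` is analogous with weight four, matching the square of the reduced
determinant. -/
theorem IsRescaling.reducedDet {t : ι → ℂ} {u u' : ι → ℂ × ℂ} (h : IsRescaling t u u')
    (s : Matrix ι ι ℂ) {a b : ι} (hab : a ≠ b) :
    reducedDet s u' a b = reducedDet s u a b / (∏ c, t c) ^ 2 := by
  have := h.ne_zero a
  have := h.ne_zero b
  unfold Split.reducedDet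
  rw [detRemove_eq_blockDet, detRemove_eq_blockDet, h.aMatrix,
    blockDet_scaleBoth, prod_compl_inv h.ne_zero,
    Finset.prod_pair hab, h.bracket]
  by_cases hb : Split.bracket u a b = 0
  · simp [hb]
  have : ∏ c, t c ≠ 0 := Finset.prod_ne_zero_iff.2 fun a _ => h.ne_zero a
  field_simp

theorem IsRescaling.isHessian {t : ι → ℂ} {u u' : ι → ℂ × ℂ} (h : IsRescaling t u u')
    {s Φ : Matrix ι ι ℂ} (hΦ : IsHessian s u Φ) :
    IsHessian s u' (scaleBoth (fun a => ((t a)⁻¹) ^ 2) Φ) := by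
  unfold scaleBoth
  refine ⟨fun a b hab => ?_, fun a c d => ?_⟩
  · rw [hΦ.off_diag a b hab, h.bracket, div_eq_mul_inv, div_eq_mul_inv, mul_pow, mul_pow, mul_inv,
      mul_inv]
    simp only [inv_pow]
    ring
  · rw [← mul_zero (((t a)⁻¹) ^ 2 * (t c * t d)), ← hΦ.null a c d, Finset.mul_sum]
    apply Finset.sum_congr rfl
    intro b _
    have := h.ne_zero b
    rw [h.bracket, h.bracket]
    field_simp

theorem IsRescaling.reducedJac {t : ι → ℂ} {u u' : ι → ℂ × ℂ} (h : IsRescaling t u u')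
    (Φ : Matrix ι ι ℂ) {p q r : ι} (hpq : p ≠ q) (hqr : q ≠ r) (hrp : r ≠ p) :
    reducedJac (scaleBoth (fun a => ((t a)⁻¹) ^ 2) Φ) u' p q r =
      reducedJac Φ u p q r / (∏ c, t c) ^ 4 := by
  have := h.ne_zero p
  have := h.ne_zero q
  have := h.ne_zero r
  unfold Split.reducedJac
  rw [detRemove_eq_blockDet, detRemove_eq_blockDet,
    blockDet_scaleBoth, Finset.prod_pow, prod_compl_inv h.ne_zero,
    Finset.prod_insert (by simp [hpq, hrp.symm]), Finset.prod_pair hqr]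
  have hF : faddeevPopov u' p q r = (t p * t q * t r) ^ 2 * faddeevPopov u p q r := by
    unfold faddeevPopov
    rw [h.bracket, h.bracket, h.bracket]
    ring
  rw [hF]
  by_cases hb : faddeevPopov u p q r = 0
  · simp [hb]
  have : ∏ c, t c ≠ 0 := Finset.prod_ne_zero_iff.2 fun a _ => h.ne_zero a
  field_simp

/-- Normalization of homogeneous coordinates. -/
def normalize (v : ℂ × ℂ) : ℂ × ℂ := if v.2 = 0 then (1, 0) else (v.1 / v.2, 1)

theorem normalize_smul {c : ℂ} (hc : c ≠ 0) (x y : ℂ) :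
    normalize (c * x, c * y) = normalize (x, y) := by
  unfold normalize
  by_cases hy : y = 0
  · simp [hy]
  · simp [hy, hc, mul_div_mul_left]

/-- The projective transformation to the gauge in which `p, q, r` sit at `0, 1, ∞`. -/
def toGauge (p q r : ι) (u : ι → ℂ × ℂ) (a : ι) : ℂ × ℂ :=
  normalize (bracket u a p * bracket u q r, bracket u a r * bracket u q p)

theorem toGauge_gaugeFixed {u : ι → ℂ × ℂ} (hne : ∀ a b, a ≠ b → bracket u a b ≠ 0) {p q r : ι}
    (hpq : p ≠ q) (hqr : q ≠ r) (hrp : r ≠ p) : GaugeFixed p q r (toGauge p q r u) := by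
  have h1 := hne _ _ hpq.symm
  have h2 := hne _ _ hqr
  have h3 := hne _ _ hrp.symm
  refine ⟨?_, ?_, ?_, fun a _ _ ha => ?_⟩
  · simp [toGauge, normalize, bracket_self, h1, h3]
  · simp [toGauge, normalize, h1, h2, mul_comm (bracket u q p)]
  · simp [toGauge, normalize, bracket_self]
  · simp [toGauge, normalize, h1, hne a r ha]

theorem toGauge_of_gaugeFixed {u : ι → ℂ × ℂ} {p q r : ι} (hu : GaugeFixed p q r u) :
    toGauge p q r u = u := by
  ext1 a
  have : normalize (u a) = u a := by
    by_cases h : a = r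
    · rw [h, hu.infty]; simp [normalize]
    · have h2 : (u a).2 = 1 := by
        by_cases hp : a = p
        · rw [hp, hu.zero]
        by_cases hq : a = q
        · rw [hq, hu.one]
        exact hu.affine a hp hq h
      unfold normalize
      rw [if_neg (by rw [h2]; exact one_ne_zero), h2, div_one, ← h2]
  conv_rhs => rw [← this, show u a = ((u a).1, (u a).2) from rfl]
  -- In this gauge the coordinates inside `toGauge` evaluate to minus those of `u a`.
  rw [← normalize_smul (c := -1) (by norm_num)]
  simp [toGauge, bracket, hu.zero, hu.one, hu.infty]

theorem IsRescaling.toGauge_eq {t : ι → ℂ} {u u' : ι → ℂ × ℂ} (h : IsRescaling t u u')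
    (p q r : ι) : toGauge p q r u' = toGauge p q r u := by
  ext1 a
  unfold toGauge
  refine Eq.trans ?_ (normalize_smul (c := t a * t p * t q * t r) (mul_ne_zero (mul_ne_zero
    (mul_ne_zero (h.ne_zero a) (h.ne_zero p)) (h.ne_zero q)) (h.ne_zero r)) _ _)
  simp only [h.bracket]
  congr 2 <;> ring

theorem exists_isRescaling_toGauge {u : ι → ℂ × ℂ} (hne : ∀ a b, a ≠ b → bracket u a b ≠ 0)
    {p q r : ι} (hpq : p ≠ q) (hqr : q ≠ r) (hrp : r ≠ p) :
    ∃ t, IsRescaling t u (toGauge p q r u) := by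
  have h1 := hne _ _ hpq.symm
  have h2 := hne _ _ hqr
  have h3 := hne _ _ hrp
  -- The radicand is the determinant of the linear map `u a ↦ v a`, which multiplies every bracket;
  -- its square root distributes this factor evenly over the two legs.
  obtain ⟨d, hd⟩ := IsAlgClosed.exists_pow_nat_eq
    (bracket u p q * bracket u q r * bracket u r p) (n := 2) (by norm_num)
  have hd0 : d ≠ 0 := by
    rintro rfl
    rw [zero_pow (by norm_num)] at hd
    exact mul_ne_zero (mul_ne_zero (hne _ _ hpq) h2) h3 hd.symm
  let v : ι → ℂ × ℂ := fun a => (bracket u a p * bracket u q r, bracket u a r * bracket u q p)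
  have hnorm : ∀ a, ∃ τ : ℂ, τ ≠ 0 ∧ toGauge p q r u a = (τ * (v a).1, τ * (v a).2) := by
    intro a
    by_cases har : a = r
    · subst har
      refine ⟨((v a).1)⁻¹, inv_ne_zero (mul_ne_zero h3 h2), ?_⟩
      simp only [toGauge, v, normalize, bracket_self, zero_mul, if_true, mul_zero]
      rw [inv_mul_cancel₀ (mul_ne_zero h3 h2)]
    · refine ⟨((v a).2)⁻¹, inv_ne_zero (mul_ne_zero (hne a r har) h1), ?_⟩
      simp only [toGauge, v, normalize]
      rw [if_neg (mul_ne_zero (hne a r har) h1), inv_mul_cancel₀ (mul_ne_zero (hne a r har) h1),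
        div_eq_inv_mul]
  choose τ hτ0 hτ using hnorm
  refine ⟨fun a => d * τ a, fun a => mul_ne_zero hd0 (hτ0 a), fun a b => ?_⟩
  have : d * τ a * (d * τ b) * bracket u a b = d ^ 2 * (τ a * τ b * bracket u a b) := by ring
  rw [this, hd]
  unfold bracket at hτ ⊢
  rw [hτ, hτ]
  simp only [v, bracket]
  ring

/-- Gauge independence of the building blocks of the amplitude. -/
theorem chySolutions_toGauge {s : Matrix ι ι ℂ} (hs : ∀ a b, s a b = s b a)
    (hs0 : ∀ a, s a a = 0) (hs1 : ∀ a, ∑ b, s a b = 0) {p q r i j k : ι}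
    (hij : i ≠ j) (hjk : j ≠ k) (hki : k ≠ i) {u : ι → ℂ × ℂ} (hu : u ∈ chySolutions s p q r) :
    toGauge i j k u ∈ chySolutions s i j k ∧ toGauge p q r (toGauge i j k u) = u ∧
      ∃ T : ℂ, T ≠ 0 ∧
        (chyJacobian s i j k (toGauge i j k u)).det = (chyJacobian s p q r u).det / T ^ 4 ∧
        ∀ a b c d, a ≠ b → c ≠ d →
          reducedDet s (toGauge i j k u) c d = reducedDet s u a b / T ^ 2 := by
  have hon := onShell_of_mem_chySolutions hs hs0 hs1 hu
  obtain ⟨hg, hne, -⟩ := hu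
  obtain ⟨hpq, hqr, hrp⟩ := hg.ne
  obtain ⟨t, ht⟩ := exists_isRescaling_toGauge hne hij hjk hki
  have hg' := toGauge_gaugeFixed hne hij hjk hki
  obtain ⟨Φ, hΦ⟩ := exists_isHessian hs0 hs1 hne hon hpq
  refine ⟨⟨hg', ht.distinct hne, fun a _ _ _ =>
    scatteringFn_eq_zero_of_onShell (ht.onShell hon) hg'.infty a⟩, ?_,
    ∏ c, t c, Finset.prod_ne_zero_iff.2 fun a _ => ht.ne_zero a, ?_, ?_⟩
  · rw [ht.toGauge_eq, toGauge_of_gaugeFixed hg]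
  · rw [(ht.isHessian hΦ).det_chyJacobian hg', hΦ.det_chyJacobian hg, ht.reducedJac Φ hij hjk hki,
      hΦ.reducedJac_eq hs hne hij hjk hki hpq hqr hrp]
  · intro a b c d hab hcd
    rw [ht.reducedDet s hcd, reducedDet_eq hs hne hon hcd hab]

theorem bijOn_toGauge {s : Matrix ι ι ℂ} (hs : ∀ a b, s a b = s b a)
    (hs0 : ∀ a, s a a = 0) (hs1 : ∀ a, ∑ b, s a b = 0) {p q r i j k : ι}
    (hpq : p ≠ q) (hqr : q ≠ r) (hrp : r ≠ p) (hij : i ≠ j) (hjk : j ≠ k) (hki : k ≠ i) :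
    Set.BijOn (toGauge i j k) (chySolutions s p q r) (chySolutions s i j k) :=
  Set.InvOn.bijOn (f' := toGauge p q r)
    ⟨fun _ hu => (chySolutions_toGauge hs hs0 hs1 hij hjk hki hu).2.1,
      fun _ hu => (chySolutions_toGauge hs hs0 hs1 hpq hqr hrp hu).2.1⟩
    (fun _ hu => (chySolutions_toGauge hs hs0 hs1 hij hjk hki hu).1)
    (fun _ hu => (chySolutions_toGauge hs hs0 hs1 hpq hqr hrp hu).1)

theorem CHYRegular.of_gauge {s : Matrix ι ι ℂ} (hs : ∀ a b, s a b = s b a)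
    (hs0 : ∀ a, s a a = 0) (hs1 : ∀ a, ∑ b, s a b = 0) {p q r i j k : ι}
    (hpq : p ≠ q) (hqr : q ≠ r) (hrp : r ≠ p) (hij : i ≠ j) (hjk : j ≠ k) (hki : k ≠ i)
    (h : CHYRegular s i j k) : CHYRegular s p q r := by
  refine ⟨((bijOn_toGauge hs hs0 hs1 hpq hqr hrp hij hjk hki).finite_iff_finite).2 h.1, ?_⟩
  intro u hu h0
  obtain ⟨hmem, -, T, -, hJ, -⟩ := chySolutions_toGauge hs hs0 hs1 hij hjk hki hu
  exact h.2 _ hmem (by rw [hJ, h0, zero_div])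

theorem GaugeFixed.faddeevPopov {u : ι → ℂ × ℂ} {p q r : ι} (hu : GaugeFixed p q r u) :
    faddeevPopov u p q r = 1 := by
  simp [Split.faddeevPopov, bracket, hu.zero, hu.one, hu.infty]

/-- The amplitude depends neither on the gauge nor on the removed legs. -/
theorem sGalAmplitude_eq {s : Matrix ι ι ℂ} (hs : ∀ a b, s a b = s b a)
    (hs0 : ∀ a, s a a = 0) (hs1 : ∀ a, ∑ b, s a b = 0) {p q r i j k a b c d : ι}
    (hpq : p ≠ q) (hqr : q ≠ r) (hrp : r ≠ p) (hij : i ≠ j) (hjk : j ≠ k) (hki : k ≠ i)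
    (hab : a ≠ b) (hcd : c ≠ d) :
    sGalAmplitude s p q r a b = sGalAmplitude s i j k c d := by
  unfold sGalAmplitude chyIntegral
  refine finsum_mem_eq_of_bijOn _ (bijOn_toGauge hs hs0 hs1 hpq hqr hrp hij hjk hki) ?_
  intro u hu
  obtain ⟨hmem, -, T, hT, hJ, hR⟩ := chySolutions_toGauge hs hs0 hs1 hij hjk hki hu
  beta_reduce
  rw [hJ, hR a b c d hab hcd, hu.1.faddeevPopov, hmem.1.faddeevPopov]
  -- A degenerate solution contributes zero in both gauges, since division by zero gives zero.
  -- Otherwise the factors `T ^ 4` cancel.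
  by_cases h0 : (chyJacobian s p q r u).det = 0
  · simp [h0]
  field_simp

end GaugeChange

/-! ### Factorization of a CHY integral over non-interacting chambers. -/

section Factorization

/-- No finiteness is assumed. If both functions are nonzero, an infinite support of either one makes
the support of the product infinite, so both sides take the default value zero. -/
theorem finsum_prod_mul {α β : Type*} (f : α → ℂ) (g : β → ℂ) :
    ∑ᶠ x : α × β, f x.1 * g x.2 = (∑ᶠ a, f a) * ∑ᶠ b, g b := by
  by_cases hf0 : f = 0
  · subst hf0; simp
  by_cases hg0 : g = 0
  · subst hg0; simp
  obtain ⟨a₀, ha₀⟩ := Function.ne_iff.1 hf0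
  obtain ⟨b₀, hb₀⟩ := Function.ne_iff.1 hg0
  have hsupp : Function.support (fun x : α × β => f x.1 * g x.2) =
      Function.support f ×ˢ Function.support g := by
    ext x; simp
  by_cases hf : (Function.support f).Finite
  · by_cases hg : (Function.support g).Finite
    · rw [finsum_curry _ (by rw [Function.HasFiniteSupport, hsupp]; exact hf.prod hg), finsum_mul' _ _ hf]
      apply finsum_congr
      intro a
      rw [mul_finsum' _ _ hg]
    · rw [finsum_of_infinite_support (f := g) hg, mul_zero, finsum_of_infinite_support]
      rw [hsupp]
      exact Set.Infinite.prod_right hg ⟨a₀, ha₀⟩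
  · rw [finsum_of_infinite_support (f := f) hf, zero_mul, finsum_of_infinite_support]
    rw [hsupp]
    exact Set.Infinite.prod_left hf ⟨b₀, hb₀⟩

theorem finsum_mem_prod_mul {α β : Type*} (S : Set α) (T : Set β) (f : α → ℂ) (g : β → ℂ) :
    ∑ᶠ x ∈ S ×ˢ T, f x.1 * g x.2 = (∑ᶠ a ∈ S, f a) * ∑ᶠ b ∈ T, g b := by
  rw [finsum_mem_def, finsum_mem_def, finsum_mem_def, ← finsum_prod_mul]
  apply finsum_congr
  rintro ⟨a, b⟩
  by_cases ha : a ∈ S <;> by_cases hb : b ∈ T <;> simp [Set.indicator, ha, hb]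

variable {ι : Type} [Fintype ι] [DecidableEq ι] {L : Type} [Fintype L] [DecidableEq L]

/-- `e` identifies the legs of a CHY integral with coefficients `c` with the gauge-fixed legs
`i, j, k` and the legs of a chamber `X`, which does not interact with the other legs. -/
structure IsChamber (s : Matrix ι ι ℂ) (i j k : ι) (X : Finset ι) (c : Matrix L L ℂ) (p q r : L)
    (e : L → ι) : Prop where
  inj : Function.Injective e
  map_zero : e p = i
  map_one : e q = j
  map_infty : e r = k
  mem_iff : ∀ x, x ∈ X ↔ ∃ a, (a ≠ p ∧ a ≠ q ∧ a ≠ r) ∧ e a = x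
  coeff : ∀ a, a ≠ p → a ≠ q → a ≠ r → ∀ b, c a b = s (e a) (e b)
  decoupled : ∀ a ∈ X, ∀ b, b ∉ X → b ≠ i → b ≠ j → b ≠ k → s a b = 0

variable {s : Matrix ι ι ℂ} {i j k : ι} {X : Finset ι} {c : Matrix L L ℂ} {p q r : L} {e : L → ι}

theorem IsChamber.mem (h : IsChamber s i j k X c p q r e) {a : L} (h₁ : a ≠ p) (h₂ : a ≠ q)
    (h₃ : a ≠ r) : e a ∈ X :=
  (h.mem_iff _).2 ⟨a, ⟨h₁, h₂, h₃⟩, rfl⟩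

theorem IsChamber.ne (h : IsChamber s i j k X c p q r e) {x : ι} (hx : x ∈ X) :
    x ≠ i ∧ x ≠ j ∧ x ≠ k := by
  obtain ⟨a, ⟨h1, h2, h3⟩, rfl⟩ := (h.mem_iff x).1 hx
  rw [← h.map_zero, ← h.map_one, ← h.map_infty]
  exact ⟨h.inj.ne h1, h.inj.ne h2, h.inj.ne h3⟩

theorem IsChamber.exists_eq (h : IsChamber s i j k X c p q r e) {x : ι}
    (hx : x = i ∨ x = j ∨ x = k ∨ x ∈ X) : ∃ a, e a = x := by
  rcases hx with rfl | rfl | rfl | hx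
  · exact ⟨p, h.map_zero⟩
  · exact ⟨q, h.map_one⟩
  · exact ⟨r, h.map_infty⟩
  · obtain ⟨a, -, ha⟩ := (h.mem_iff x).1 hx
    exact ⟨a, ha⟩

theorem IsChamber.eq_or_mem (h : IsChamber s i j k X c p q r e) (a : L) :
    e a = i ∨ e a = j ∨ e a = k ∨ e a ∈ X := by
  by_cases h1 : a = p
  · exact Or.inl (h1 ▸ h.map_zero)
  by_cases h2 : a = q
  · exact Or.inr (Or.inl (h2 ▸ h.map_one))
  by_cases h3 : a = r
  · exact Or.inr (Or.inr (Or.inl (h3 ▸ h.map_infty)))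
  exact Or.inr (Or.inr (Or.inr (h.mem h1 h2 h3)))

theorem bracket_comp (u : ι → ℂ × ℂ) (e : L → ι) (a b : L) :
    bracket (u ∘ e) a b = bracket u (e a) (e b) := rfl

/-- The terms outside the image of `e` vanish by decoupling. This transfers both the scattering
functions and the diagonal of the Hessian. -/
theorem IsChamber.sum_erase (h : IsChamber s i j k X c p q r e) {a : L} (h₁ : a ≠ p) (h₂ : a ≠ q)
    (h₃ : a ≠ r) (f : ι → ℂ) :
    ∑ b ∈ univ.erase a, c a b * f (e b) = ∑ x ∈ univ.erase (e a), s (e a) x * f x := by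
  apply Finset.sum_of_injOn e h.inj.injOn
  · intro b hb
    simpa [h.inj.eq_iff] using hb
  · intro x hx hx'
    have hnr : ∀ b, e b ≠ x := by
      rintro b rfl
      exact hx' ⟨b, by simpa [h.inj.eq_iff] using hx, rfl⟩
    rw [h.decoupled (e a) (h.mem h₁ h₂ h₃) x, zero_mul]
    · exact fun hX => (h.exists_eq (Or.inr (Or.inr (Or.inr hX)))).elim hnr
    · exact fun hX => hnr p (h.map_zero.trans hX.symm)
    · exact fun hX => hnr q (h.map_one.trans hX.symm)
    · exact fun hX => hnr r (h.map_infty.trans hX.symm)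
  · intro b _
    rw [h.coeff a h₁ h₂ h₃]

theorem IsChamber.scatteringFn (h : IsChamber s i j k X c p q r e) (u : ι → ℂ × ℂ) {a : L}
    (h₁ : a ≠ p) (h₂ : a ≠ q) (h₃ : a ≠ r) :
    scatteringFn c (u ∘ e) a = scatteringFn s u (e a) := by
  unfold Split.scatteringFn
  simp only [mul_div_assoc]
  exact h.sum_erase h₁ h₂ h₃ fun x => (u x).2 / bracket u (e a) x

theorem IsChamber.gaugeFixed (h : IsChamber s i j k X c p q r e) {u : ι → ℂ × ℂ}
    (hu : GaugeFixed i j k u) : GaugeFixed p q r (u ∘ e) := by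
  refine ⟨?_, ?_, ?_, fun a h1 h2 h3 => ?_⟩
  · rw [Function.comp_apply, h.map_zero, hu.zero]
  · rw [Function.comp_apply, h.map_one, hu.one]
  · rw [Function.comp_apply, h.map_infty, hu.infty]
  · obtain ⟨h4, h5, h6⟩ := h.ne (h.mem h1 h2 h3)
    exact hu.affine _ h4 h5 h6

theorem IsChamber.comp_mem_chySolutions (h : IsChamber s i j k X c p q r e) {u : ι → ℂ × ℂ}
    (hu : u ∈ chySolutions s i j k) : u ∘ e ∈ chySolutions c p q r := by
  refine ⟨h.gaugeFixed hu.1, fun a b hab => hu.2.1 _ _ (h.inj.ne hab), fun a h1 h2 h3 => ?_⟩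
  obtain ⟨h4, h5, h6⟩ := h.ne (h.mem h1 h2 h3)
  rw [h.scatteringFn u h1 h2 h3]
  exact hu.2.2 _ h4 h5 h6

/-- The Hessian of the CHY potential in the affine coordinates of all legs. -/
def affineHessian (s : Matrix ι ι ℂ) (u : ι → ℂ × ℂ) : Matrix ι ι ℂ := fun a b =>
  if a = b then -∑ d ∈ univ.erase a, s a d * (u d).2 ^ 2 / bracket u a d ^ 2
  else s a b / bracket u a b ^ 2

theorem det_chyJacobian_eq_blockDet (s : Matrix ι ι ℂ) (i j k : ι) (u : ι → ℂ × ℂ) :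
    (chyJacobian s i j k u).det = blockDet (affineHessian s u) {i, j, k}ᶜ := by
  rw [← det_submatrix_eq_blockDet _ _ (Subtype.val : Free i j k → ι) Subtype.val_injective
    (by simp)]
  congr 1
  ext a b
  by_cases hab : a = b
  · subst hab
    simp [chyJacobian, affineHessian]
  · have : (a : ι) ≠ b := fun h => hab (Subtype.ext h)
    simp [chyJacobian, affineHessian, hab, this]

theorem IsChamber.det_chyJacobian (h : IsChamber s i j k X c p q r e) (u : ι → ℂ × ℂ) :
    (chyJacobian c p q r (u ∘ e)).det = blockDet (affineHessian s u) X := by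
  rw [← det_submatrix_eq_blockDet _ _ (fun a : Free p q r => e a)
    (h.inj.comp Subtype.val_injective)]
  · congr 1
    ext a b
    by_cases hab : a = b
    · subst hab
      rw [chyJacobian, if_pos rfl, Matrix.submatrix_apply, affineHessian, if_pos rfl]
      simp only [mul_div_assoc]
      exact congrArg _ (h.sum_erase a.2.1 a.2.2.1 a.2.2.2
        fun x => (u x).2 ^ 2 / bracket u (e a) x ^ 2)
    · have : e a ≠ e b := fun h' => hab (Subtype.ext (h.inj h'))
      rw [chyJacobian, if_neg hab, Matrix.submatrix_apply, affineHessian, if_neg this,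
        h.coeff a a.2.1 a.2.2.1 a.2.2.2, bracket_comp]
  · intro x
    rw [h.mem_iff]
    exact ⟨fun ⟨a, ha, hx⟩ => ⟨⟨a, ha⟩, hx⟩, fun ⟨a, hx⟩ => ⟨a, a.2, hx⟩⟩

/-- The free legs are distributed among three chambers that do not interact. -/
structure IsSplitting {L₁ L₂ L₃ : Type} [Fintype L₁] [DecidableEq L₁] [Fintype L₂] [DecidableEq L₂]
    [Fintype L₃] [DecidableEq L₃] (s : Matrix ι ι ℂ) (i j k : ι) (X₁ X₂ X₃ : Finset ι)
    (c₁ : Matrix L₁ L₁ ℂ) (p₁ q₁ r₁ : L₁) (e₁ : L₁ → ι)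
    (c₂ : Matrix L₂ L₂ ℂ) (p₂ q₂ r₂ : L₂) (e₂ : L₂ → ι)
    (c₃ : Matrix L₃ L₃ ℂ) (p₃ q₃ r₃ : L₃) (e₃ : L₃ → ι) : Prop where
  fst : IsChamber s i j k X₁ c₁ p₁ q₁ r₁ e₁
  snd : IsChamber s i j k X₂ c₂ p₂ q₂ r₂ e₂
  trd : IsChamber s i j k X₃ c₃ p₃ q₃ r₃ e₃
  cover : ({i, j, k} : Finset ι)ᶜ = X₁ ∪ (X₂ ∪ X₃)
  disj₁₂ : Disjoint X₁ X₂
  disj₁₃ : Disjoint X₁ X₃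
  disj₂₃ : Disjoint X₂ X₃

section Splitting

variable {L₁ L₂ L₃ : Type} [Fintype L₁] [DecidableEq L₁] [Fintype L₂] [DecidableEq L₂]
  [Fintype L₃] [DecidableEq L₃] {X₁ X₂ X₃ : Finset ι}
  {c₁ : Matrix L₁ L₁ ℂ} {p₁ q₁ r₁ : L₁} {e₁ : L₁ → ι}
  {c₂ : Matrix L₂ L₂ ℂ} {p₂ q₂ r₂ : L₂} {e₂ : L₂ → ι}
  {c₃ : Matrix L₃ L₃ ℂ} {p₃ q₃ r₃ : L₃} {e₃ : L₃ → ι}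

theorem IsSplitting.cases
    (h : IsSplitting s i j k X₁ X₂ X₃ c₁ p₁ q₁ r₁ e₁ c₂ p₂ q₂ r₂ e₂ c₃ p₃ q₃ r₃ e₃) (x : ι) :
    (x = i ∨ x = j ∨ x = k) ∨ x ∈ X₁ ∨ x ∈ X₂ ∨ x ∈ X₃ := by
  by_cases hx : x ∈ ({i, j, k} : Finset ι)ᶜ
  · rw [h.cover] at hx
    simpa using Or.inr hx
  · left
    simpa [or_iff_not_imp_left] using hx

theorem IsSplitting.det_chyJacobian
    (h : IsSplitting s i j k X₁ X₂ X₃ c₁ p₁ q₁ r₁ e₁ c₂ p₂ q₂ r₂ e₂ c₃ p₃ q₃ r₃ e₃)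
    (u : ι → ℂ × ℂ) :
    (chyJacobian s i j k u).det = (chyJacobian c₁ p₁ q₁ r₁ (u ∘ e₁)).det *
      ((chyJacobian c₂ p₂ q₂ r₂ (u ∘ e₂)).det * (chyJacobian c₃ p₃ q₃ r₃ (u ∘ e₃)).det) := by
  rw [det_chyJacobian_eq_blockDet, h.fst.det_chyJacobian, h.snd.det_chyJacobian,
    h.trd.det_chyJacobian, h.cover, blockDet_union, blockDet_union _ h.disj₂₃]
  · intro a ha b hb
    obtain ⟨h1, h2, h3⟩ := h.snd.ne hb
    rw [affineHessian, if_neg (ne_of_mem_of_not_mem hb (Finset.disjoint_right.1 h.disj₂₃ ha)).symm,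
      h.trd.decoupled a ha b (Finset.disjoint_left.1 h.disj₂₃ hb) h1 h2 h3, zero_div]
  · rw [Finset.disjoint_union_right]
    exact ⟨h.disj₁₂, h.disj₁₃⟩
  · intro a ha b hb
    obtain ⟨h1, h2, h3⟩ := h.fst.ne hb
    have hab : a ≠ b := by
      rintro rfl
      rcases Finset.mem_union.1 ha with ha | ha
      · exact Finset.disjoint_left.1 h.disj₁₂ hb ha
      · exact Finset.disjoint_left.1 h.disj₁₃ hb ha
    rw [affineHessian, if_neg hab]
    rcases Finset.mem_union.1 ha with ha | ha
    · rw [h.snd.decoupled a ha b (Finset.disjoint_left.1 h.disj₁₂ hb) h1 h2 h3, zero_div]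
    · rw [h.trd.decoupled a ha b (Finset.disjoint_left.1 h.disj₁₃ hb) h1 h2 h3, zero_div]

theorem IsSplitting.injective
    (h : IsSplitting s i j k X₁ X₂ X₃ c₁ p₁ q₁ r₁ e₁ c₂ p₂ q₂ r₂ e₂ c₃ p₃ q₃ r₃ e₃) :
    Function.Injective fun u : ι → ℂ × ℂ => (u ∘ e₁, u ∘ e₂, u ∘ e₃) := by
  intro u v huv
  obtain ⟨h1, h2, h3⟩ : u ∘ e₁ = v ∘ e₁ ∧ u ∘ e₂ = v ∘ e₂ ∧ u ∘ e₃ = v ∘ e₃ := by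
    simpa [Prod.ext_iff] using huv
  ext1 x
  rcases h.cases x with hx | hx | hx | hx
  · obtain ⟨a, rfl⟩ := h.fst.exists_eq (x := x) (by tauto)
    exact congrFun h1 a
  · obtain ⟨a, rfl⟩ := h.fst.exists_eq (x := x) (by tauto)
    exact congrFun h1 a
  · obtain ⟨a, rfl⟩ := h.snd.exists_eq (x := x) (by tauto)
    exact congrFun h2 a
  · obtain ⟨a, rfl⟩ := h.trd.exists_eq (x := x) (by tauto)
    exact congrFun h3 a

theorem IsSplitting.mapsTo
    (h : IsSplitting s i j k X₁ X₂ X₃ c₁ p₁ q₁ r₁ e₁ c₂ p₂ q₂ r₂ e₂ c₃ p₃ q₃ r₃ e₃) :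
    Set.MapsTo (fun u : ι → ℂ × ℂ => (u ∘ e₁, u ∘ e₂, u ∘ e₃)) (chySolutions s i j k)
      (chySolutions c₁ p₁ q₁ r₁ ×ˢ (chySolutions c₂ p₂ q₂ r₂ ×ˢ chySolutions c₃ p₃ q₃ r₃)) :=
  fun _ hu => ⟨h.fst.comp_mem_chySolutions hu, h.snd.comp_mem_chySolutions hu,
    h.trd.comp_mem_chySolutions hu⟩

/-- Finiteness needs only the injection of solutions into triples, so collisions between chambers
need not be excluded here. -/
theorem IsSplitting.chyRegular
    (h : IsSplitting s i j k X₁ X₂ X₃ c₁ p₁ q₁ r₁ e₁ c₂ p₂ q₂ r₂ e₂ c₃ p₃ q₃ r₃ e₃)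
    (h₁ : CHYRegular c₁ p₁ q₁ r₁) (h₂ : CHYRegular c₂ p₂ q₂ r₂) (h₃ : CHYRegular c₃ p₃ q₃ r₃) :
    CHYRegular s i j k := by
  refine ⟨Set.Finite.of_injOn h.mapsTo h.injective.injOn (h₁.1.prod (h₂.1.prod h₃.1)),
    fun u hu => ?_⟩
  obtain ⟨m1, m2, m3⟩ := h.mapsTo hu
  rw [h.det_chyJacobian]
  exact mul_ne_zero (h₁.2 _ m1) (mul_ne_zero (h₂.2 _ m2) (h₃.2 _ m3))

/-- Solutions in the three chambers glue to a solution, provided that collisions of punctures in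
different chambers are excluded. -/
theorem IsSplitting.surjOn
    (h : IsSplitting s i j k X₁ X₂ X₃ c₁ p₁ q₁ r₁ e₁ c₂ p₂ q₂ r₂ e₂ c₃ p₃ q₃ r₃ e₃)
    (hsep : ∀ u : ι → ℂ × ℂ, GaugeFixed i j k u →
      (∀ a b, e₁ a ≠ e₁ b → bracket u (e₁ a) (e₁ b) ≠ 0) →
      (∀ a b, e₂ a ≠ e₂ b → bracket u (e₂ a) (e₂ b) ≠ 0) →
      (∀ a b, e₃ a ≠ e₃ b → bracket u (e₃ a) (e₃ b) ≠ 0) →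
      (∀ a, a ≠ i → a ≠ j → a ≠ k → scatteringFn s u a = 0) →
      ∀ a b, a ≠ b → bracket u a b ≠ 0) :
    Set.SurjOn (fun u : ι → ℂ × ℂ => (u ∘ e₁, u ∘ e₂, u ∘ e₃)) (chySolutions s i j k)
      (chySolutions c₁ p₁ q₁ r₁ ×ˢ (chySolutions c₂ p₂ q₂ r₂ ×ˢ chySolutions c₃ p₃ q₃ r₃)) := by
  rintro ⟨v₁, v₂, v₃⟩ ⟨h1, h2, h3⟩
  dsimp only at h1 h2 h3
  -- The three solutions overlap only at the legs `i, j, k`, where the common gauge makes them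
  -- agree. The final default `0` is never reached, because the chambers and fixed legs exhaust all
  -- labels.
  let u : ι → ℂ × ℂ := Function.extend e₁ v₁ (Function.extend e₂ v₂ (Function.extend e₃ v₃ 0))
  have hu1 : u ∘ e₁ = v₁ := by
    ext1 a
    exact h.fst.inj.extend_apply _ _ a
  have hg : u i = (0, 1) ∧ u j = (1, 1) ∧ u k = (1, 0) := by
    rw [← h1.1.zero, ← h1.1.one, ← h1.1.infty, ← hu1, Function.comp_apply, Function.comp_apply,
      Function.comp_apply, h.fst.map_zero, h.fst.map_one, h.fst.map_infty]
    exact ⟨rfl, rfl, rfl⟩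
  have hout : ∀ {x}, x ∉ X₁ → x ≠ i → x ≠ j → x ≠ k →
      u x = Function.extend e₂ v₂ (Function.extend e₃ v₃ 0) x := by
    intro x hx hxi hxj hxk
    apply Function.extend_apply'
    rintro ⟨a, rfl⟩
    rcases h.fst.eq_or_mem a with h | h | h | h <;> contradiction
  have hu2 : u ∘ e₂ = v₂ := by
    ext1 a
    rw [Function.comp_apply]
    by_cases ha1 : a = p₂
    · rw [ha1, h.snd.map_zero, hg.1, h2.1.zero]
    by_cases ha2 : a = q₂
    · rw [ha2, h.snd.map_one, hg.2.1, h2.1.one]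
    by_cases ha3 : a = r₂
    · rw [ha3, h.snd.map_infty, hg.2.2, h2.1.infty]
    have hm := h.snd.mem ha1 ha2 ha3
    obtain ⟨n1, n2, n3⟩ := h.snd.ne hm
    rw [hout (Finset.disjoint_right.1 h.disj₁₂ hm) n1 n2 n3]
    exact h.snd.inj.extend_apply _ _ a
  have hu3 : u ∘ e₃ = v₃ := by
    ext1 a
    rw [Function.comp_apply]
    by_cases ha1 : a = p₃
    · rw [ha1, h.trd.map_zero, hg.1, h3.1.zero]
    by_cases ha2 : a = q₃
    · rw [ha2, h.trd.map_one, hg.2.1, h3.1.one]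
    by_cases ha3 : a = r₃
    · rw [ha3, h.trd.map_infty, hg.2.2, h3.1.infty]
    have hm := h.trd.mem ha1 ha2 ha3
    obtain ⟨n1, n2, n3⟩ := h.trd.ne hm
    rw [hout (Finset.disjoint_right.1 h.disj₁₃ hm) n1 n2 n3, Function.extend_apply']
    · exact h.trd.inj.extend_apply _ _ a
    · rintro ⟨b, hb⟩
      have := Finset.disjoint_right.1 h.disj₂₃ hm
      rcases h.snd.eq_or_mem b with h | h | h | h <;> rw [hb] at h <;> contradiction
  clear_value u
  subst hu1 hu2 hu3
  have free : ∀ P : ι → Prop, (∀ a, a ≠ p₁ → a ≠ q₁ → a ≠ r₁ → P (e₁ a)) →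
      (∀ a, a ≠ p₂ → a ≠ q₂ → a ≠ r₂ → P (e₂ a)) → (∀ a, a ≠ p₃ → a ≠ q₃ → a ≠ r₃ → P (e₃ a)) →
      ∀ x, x ≠ i → x ≠ j → x ≠ k → P x := by
    intro P f1 f2 f3 x n1 n2 n3
    rcases h.cases x with hx | hx | hx | hx
    · tauto
    · obtain ⟨a, ⟨m1, m2, m3⟩, rfl⟩ := (h.fst.mem_iff x).1 hx
      exact f1 a m1 m2 m3
    · obtain ⟨a, ⟨m1, m2, m3⟩, rfl⟩ := (h.snd.mem_iff x).1 hx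
      exact f2 a m1 m2 m3
    · obtain ⟨a, ⟨m1, m2, m3⟩, rfl⟩ := (h.trd.mem_iff x).1 hx
      exact f3 a m1 m2 m3
  have hG : GaugeFixed i j k u :=
    ⟨hg.1, hg.2.1, hg.2.2, free _ h1.1.affine h2.1.affine h3.1.affine⟩
  have hS : ∀ a, a ≠ i → a ≠ j → a ≠ k → scatteringFn s u a = 0 := by
    refine free _ (fun a m1 m2 m3 => ?_) (fun a m1 m2 m3 => ?_) fun a m1 m2 m3 => ?_
    · rw [← h.fst.scatteringFn u m1 m2 m3]
      exact h1.2.2 a m1 m2 m3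
    · rw [← h.snd.scatteringFn u m1 m2 m3]
      exact h2.2.2 a m1 m2 m3
    · rw [← h.trd.scatteringFn u m1 m2 m3]
      exact h3.2.2 a m1 m2 m3
  refine ⟨u, ⟨hG, hsep u hG ?_ ?_ ?_ hS, hS⟩, rfl⟩
  · exact fun a b hab => h1.2.1 a b (ne_of_apply_ne _ hab)
  · exact fun a b hab => h2.2.1 a b (ne_of_apply_ne _ hab)
  · exact fun a b hab => h3.2.1 a b (ne_of_apply_ne _ hab)

theorem IsSplitting.chyIntegral
    (h : IsSplitting s i j k X₁ X₂ X₃ c₁ p₁ q₁ r₁ e₁ c₂ p₂ q₂ r₂ e₂ c₃ p₃ q₃ r₃ e₃)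
    (hsep : ∀ u : ι → ℂ × ℂ, GaugeFixed i j k u →
      (∀ a b, e₁ a ≠ e₁ b → bracket u (e₁ a) (e₁ b) ≠ 0) →
      (∀ a b, e₂ a ≠ e₂ b → bracket u (e₂ a) (e₂ b) ≠ 0) →
      (∀ a b, e₃ a ≠ e₃ b → bracket u (e₃ a) (e₃ b) ≠ 0) →
      (∀ a, a ≠ i → a ≠ j → a ≠ k → scatteringFn s u a = 0) →
      ∀ a b, a ≠ b → bracket u a b ≠ 0)
    (F : (ι → ℂ × ℂ) → ℂ) (F₁ : (L₁ → ℂ × ℂ) → ℂ) (F₂ : (L₂ → ℂ × ℂ) → ℂ) (F₃ : (L₃ → ℂ × ℂ) → ℂ)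
    (hF : ∀ u ∈ chySolutions s i j k, F u = F₁ (u ∘ e₁) * (F₂ (u ∘ e₂) * F₃ (u ∘ e₃))) :
    chyIntegral s i j k F =
      chyIntegral c₁ p₁ q₁ r₁ F₁ * (chyIntegral c₂ p₂ q₂ r₂ F₂ * chyIntegral c₃ p₃ q₃ r₃ F₃) := by
  unfold Split.chyIntegral
  rw [← finsum_mem_prod_mul, ← finsum_mem_prod_mul (chySolutions c₁ p₁ q₁ r₁)
    (chySolutions c₂ p₂ q₂ r₂ ×ˢ chySolutions c₃ p₃ q₃ r₃) _ fun x =>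
      F₂ x.1 / (chyJacobian c₂ p₂ q₂ r₂ x.1).det * (F₃ x.2 / (chyJacobian c₃ p₃ q₃ r₃ x.2).det)]
  refine finsum_mem_eq_of_bijOn _ ⟨h.mapsTo, h.injective.injOn, h.surjOn hsep⟩ fun u hu => ?_
  rw [hF u hu, h.det_chyJacobian u, mul_div_mul_comm, mul_div_mul_comm]

end Splitting
end Factorization

/-! ### Cyclic intervals of particles, and the currents as chambers of the split kinematics. -/

section Particles

variable {n : ℕ}

theorem CycLt.rot {a b c : Particle n} (h : CycLt a b c) : CycLt b c a := by
  unfold CycLt at *; tauto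

theorem IsSplit.rot {i j k : Particle n} {s : Matrix (Particle n) (Particle n) ℂ}
    (h : IsSplit i j k s) : IsSplit j k i s := fun a b hab => h a b (by
  unfold Interlaces at *; tauto)

/-- The open cyclic interval from `x` to `y`. -/
def chamber (x y : Particle n) : Finset (Particle n) := univ.filter fun a => CycLt x a y

theorem mem_chamber {x y a : Particle n} : a ∈ chamber x y ↔ CycLt x a y := by
  simp [chamber]

theorem mem_block {x y a : Particle n} : a ∈ block x y ↔ a = x ∨ a = y ∨ CycLt x a y := by
  simp [block]

theorem CycLt.cases {x y z : Particle n} (h : CycLt x y z) (b : Particle n) :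
    (b = x ∨ b = y ∨ b = z) ∨ CycLt x b y ∨ CycLt y b z ∨ CycLt z b x := by
  unfold CycLt at *
  simp only [Subtype.ext_iff, ← Subtype.coe_lt_coe] at *
  omega

theorem CycLt.ne {x y z : Particle n} (h : CycLt x y z) : x ≠ y ∧ y ≠ z ∧ z ≠ x := by
  unfold CycLt at *
  simp only [ne_eq, Subtype.ext_iff, ← Subtype.coe_lt_coe] at *
  omega

theorem CycLt.not_mem_block {x y z : Particle n} (h : CycLt x y z) : z ∉ block x y := by
  rw [mem_block]
  unfold CycLt at *
  simp only [Subtype.ext_iff, ← Subtype.coe_lt_coe] at *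
  omega

theorem disjoint_chamber {x y z : Particle n} (h : CycLt x y z) :
    Disjoint (chamber x y) (chamber y z) := by
  rw [Finset.disjoint_left]
  intro a ha hb
  rw [mem_chamber] at ha hb
  unfold CycLt at *
  simp only [← Subtype.coe_lt_coe] at *
  omega

theorem IsSplit.decoupled {x y z : Particle n} {s : Matrix (Particle n) (Particle n) ℂ}
    (h : IsSplit x y z s) (hc : CycLt x y z) {a : Particle n} (ha : a ∈ chamber x y)
    {b : Particle n} (hb : b ∉ chamber x y) (hx : b ≠ x) (hy : b ≠ y) (hz : b ≠ z) :
    s a b = 0 := by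
  apply h
  rw [mem_chamber] at ha hb
  rcases hc.cases b with h1 | h1 | h1 | h1
  · tauto
  · exact absurd h1 hb
  · exact Or.inl (Or.inr (Or.inl ⟨ha, h1⟩))
  · exact Or.inr (Or.inl ⟨h1, ha⟩)

/-- The particle label of a leg of a current, the off-shell leg being labelled `z`. -/
def legLabel {T : Finset (Particle n)} (z : Particle n) (o : Option ↥T) : Particle n :=
  o.elim z Subtype.val

theorem legLabel_injective {T : Finset (Particle n)} {z : Particle n} (hz : z ∉ T) :
    Function.Injective (legLabel z : Option ↥T → Particle n) := by
  rintro (_ | a) (_ | b) h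
  · rfl
  · exact absurd (show z ∈ T from (show z = b from h) ▸ b.2) hz
  · exact absurd (show z ∈ T from (show (a : Particle n) = z from h) ▸ a.2) hz
  · exact congrArg some (Subtype.ext h)

/-- The off-shell corrections sit on pairs of gauge-fixed legs, so they enter no scattering equation
of a free leg. -/
theorem naculichCoeff_of_free {L : Type} [Fintype L] [DecidableEq L] (G : Matrix L L ℂ)
    {p q r a : L} (h₁ : a ≠ p) (h₂ : a ≠ q) (h₃ : a ≠ r) (b : L) :
    naculichCoeff G p q r a b = G a b := by
  simp [naculichCoeff, h₁, h₂, h₃]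

theorem mem_chamber_iff_legLabel {x y z : Particle n} (hc : CycLt x y z) (a : Particle n) :
    a ∈ chamber x y ↔ ∃ o : Option ↥(block x y),
      (o ≠ some (blockFst x y) ∧ o ≠ some (blockSnd x y) ∧ o ≠ none) ∧ legLabel z o = a := by
  rw [mem_chamber]
  constructor
  · intro h
    obtain ⟨h1, h2, -⟩ := h.ne
    refine ⟨some ⟨a, mem_block.2 (Or.inr (Or.inr h))⟩, ⟨?_, ?_, ?_⟩, rfl⟩
    · exact fun h' => h1 (congrArg Subtype.val (Option.some.inj h')).symm
    · exact fun h' => h2 (congrArg Subtype.val (Option.some.inj h'))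
    · exact Option.some_ne_none _
  · rintro ⟨_ | ⟨b, hb⟩, ⟨h1, h2, h3⟩, rfl⟩
    · exact absurd rfl h3
    · rcases mem_block.1 hb with rfl | rfl | h
      · exact absurd rfl h1
      · exact absurd rfl h2
      · exact h

/-- For `a` in the open chamber, `s a b` vanishes for every `b` outside the block except `z`.
Conservation then gives `s a z` as the product with the off-shell leg, which thus takes over the
label and puncture of the third fixed particle. -/
theorem offShellGram_eq {s : Matrix (Particle n) (Particle n) ℂ} (hs : IsMandelstam s)
    {x y z : Particle n} (hsp : IsSplit x y z s) (hc : CycLt x y z) {o : Option ↥(block x y)}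
    (h₁ : o ≠ some (blockFst x y)) (h₂ : o ≠ some (blockSnd x y)) (h₃ : o ≠ none)
    (o' : Option ↥(block x y)) :
    offShellGram s (block x y) o o' = s (legLabel z o) (legLabel z o') := by
  have hm := (mem_chamber_iff_legLabel hc _).2 ⟨o, ⟨h₁, h₂, h₃⟩, rfl⟩
  rcases o with _ | a
  · exact absurd rfl h₃
  rcases o' with _ | b
  · change -∑ b ∈ block x y, s a b = s a z
    have hz := hc.not_mem_block
    rw [neg_eq_iff_add_eq_zero, add_comm, ← Finset.sum_insert hz, ← hs.conservation a]
    apply Finset.sum_subset (Finset.subset_univ _)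
    intro b _ hb
    rw [Finset.mem_insert, mem_block, ← mem_chamber (x := x)] at hb
    push Not at hb
    exact hsp.decoupled hc hm hb.2.2.2 hb.2.1 hb.2.2.1 hb.1
  · rfl

theorem offShellGram_some {s : Matrix (Particle n) (Particle n) ℂ} {T : Finset (Particle n)}
    (z : Particle n) {o o' : Option ↥T} (h : o ≠ none) (h' : o' ≠ none) :
    offShellGram s T o o' = s (legLabel z o) (legLabel z o') := by
  rcases o with _ | a
  · exact absurd rfl h
  rcases o' with _ | b
  · exact absurd rfl h'
  rfl

/-- Once the off-shell leg is removed, every entry is an ordinary Mandelstam invariant, including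
those between two fixed on-shell legs. -/
theorem detRemove_aMatrix_offShellGram (s : Matrix (Particle n) (Particle n) ℂ)
    {T : Finset (Particle n)} {z : Particle n} (hz : z ∉ T) (u : Particle n → ℂ × ℂ)
    {β : Finset (Option ↥T)} (hβ : none ∈ β) {Y : Finset (Particle n)}
    (hY : ∀ x, x ∈ Y ↔ ∃ o : Option ↥T, o ∉ β ∧ legLabel z o = x) :
    detRemove (aMatrix (offShellGram s T) (u ∘ legLabel z)) β = blockDet (aMatrix s u) Y := by
  rw [← det_submatrix_eq_blockDet (aMatrix s u) Y
    (fun o : {o : Option ↥T // o ∉ β} => legLabel z o.1)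
    ((legLabel_injective hz).comp Subtype.val_injective)]
  · unfold detRemove
    congr 1
    ext o o'
    simp only [Matrix.submatrix_apply, aMatrix, (legLabel_injective hz).eq_iff, bracket_comp]
    rw [offShellGram_some z (ne_of_mem_of_not_mem hβ o.2).symm (ne_of_mem_of_not_mem hβ o'.2).symm]
  · intro x
    rw [hY]
    exact ⟨fun ⟨o, ho, hx⟩ => ⟨⟨o, ho⟩, hx⟩, fun ⟨o, hx⟩ => ⟨o, o.2, hx⟩⟩

theorem isChamber_fst {s : Matrix (Particle n) (Particle n) ℂ} (hs : IsMandelstam s)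
    {i j k : Particle n} (hsp : IsSplit i j k s) (hc : CycLt i j k) :
    IsChamber s i j k (chamber i j)
      (naculichCoeff (offShellGram s (block i j)) (some (blockFst i j)) (some (blockSnd i j)) none)
      (some (blockFst i j)) (some (blockSnd i j)) none (legLabel k) where
  inj := legLabel_injective hc.not_mem_block
  map_zero := rfl
  map_one := rfl
  map_infty := rfl
  mem_iff := mem_chamber_iff_legLabel hc
  coeff a h1 h2 h3 b := by
    rw [naculichCoeff_of_free _ h1 h2 h3, offShellGram_eq hs hsp hc h1 h2 h3]
  decoupled a ha b hb h1 h2 h3 := hsp.decoupled hc ha hb h1 h2 h3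

theorem isChamber_snd {s : Matrix (Particle n) (Particle n) ℂ} (hs : IsMandelstam s)
    {i j k : Particle n} (hsp : IsSplit i j k s) (hc : CycLt i j k) :
    IsChamber s i j k (chamber j k)
      (naculichCoeff (offShellGram s (block j k)) none (some (blockFst j k)) (some (blockSnd j k)))
      none (some (blockFst j k)) (some (blockSnd j k)) (legLabel i) where
  inj := legLabel_injective hc.rot.not_mem_block
  map_zero := rfl
  map_one := rfl
  map_infty := rfl
  mem_iff a := by
    rw [mem_chamber_iff_legLabel hc.rot]
    exact exists_congr fun o => by tauto
  coeff a h1 h2 h3 b := by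
    rw [naculichCoeff_of_free _ h1 h2 h3, offShellGram_eq hs hsp.rot hc.rot h2 h3 h1]
  decoupled a ha b hb h1 h2 h3 := hsp.rot.decoupled hc.rot ha hb h2 h3 h1

theorem isChamber_trd {s : Matrix (Particle n) (Particle n) ℂ} (hs : IsMandelstam s)
    {i j k : Particle n} (hsp : IsSplit i j k s) (hc : CycLt i j k) :
    IsChamber s i j k (chamber k i)
      (naculichCoeff (offShellGram s (block k i)) (some (blockSnd k i)) none (some (blockFst k i)))
      (some (blockSnd k i)) none (some (blockFst k i)) (legLabel j) where
  inj := legLabel_injective hc.rot.rot.not_mem_block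
  map_zero := rfl
  map_one := rfl
  map_infty := rfl
  mem_iff a := by
    rw [mem_chamber_iff_legLabel hc.rot.rot]
    exact exists_congr fun o => by tauto
  coeff a h1 h2 h3 b := by
    rw [naculichCoeff_of_free _ h1 h2 h3, offShellGram_eq hs hsp.rot.rot hc.rot.rot h3 h1 h2]
  decoupled a ha b hb h1 h2 h3 := hsp.rot.rot.decoupled hc.rot.rot ha hb h3 h1 h2

theorem isSplitting {s : Matrix (Particle n) (Particle n) ℂ} (hs : IsMandelstam s)
    {i j k : Particle n} (hsp : IsSplit i j k s) (hc : CycLt i j k) :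
    IsSplitting s i j k (chamber i j) (chamber j k) (chamber k i)
      (naculichCoeff (offShellGram s (block i j)) (some (blockFst i j)) (some (blockSnd i j)) none)
      (some (blockFst i j)) (some (blockSnd i j)) none (legLabel k)
      (naculichCoeff (offShellGram s (block j k)) none (some (blockFst j k)) (some (blockSnd j k)))
      none (some (blockFst j k)) (some (blockSnd j k)) (legLabel i)
      (naculichCoeff (offShellGram s (block k i)) (some (blockSnd k i)) none (some (blockFst k i)))
      (some (blockSnd k i)) none (some (blockFst k i)) (legLabel j) where
  fst := isChamber_fst hs hsp hc
  snd := isChamber_snd hs hsp hc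
  trd := isChamber_trd hs hsp hc
  cover := by
    ext x
    simp only [Finset.mem_compl, Finset.mem_insert, Finset.mem_singleton, Finset.mem_union]
    constructor
    · intro hx
      simp only [mem_chamber]
      exact (hc.cases x).resolve_left hx
    · rintro (hx | hx | hx)
      · have := (isChamber_fst hs hsp hc).ne hx
        tauto
      · have := (isChamber_snd hs hsp hc).ne hx
        tauto
      · have := (isChamber_trd hs hsp hc).ne hx
        tauto
  disj₁₂ := disjoint_chamber hc
  disj₁₃ := (disjoint_chamber hc.rot.rot).symm
  disj₂₃ := disjoint_chamber hc.rot

/-- On the split subspace the determinant splits when the minor of the first chamber vanishes. -/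
theorem detRemove_aMatrix_split {s : Matrix (Particle n) (Particle n) ℂ} (hs : IsMandelstam s)
    {i j k : Particle n} (hsp : IsSplit i j k s) (hc : CycLt i j k) (u : Particle n → ℂ × ℂ)
    (h₀ : blockDet (aMatrix s u) (chamber i j) = 0) :
    detRemove (aMatrix s u) {i, k} = blockDet (aMatrix s u) (insert j (chamber i j)) *
      (blockDet (aMatrix s u) (chamber j k) * blockDet (aMatrix s u) (chamber k i)) := by
  have H := isSplitting hs hsp hc
  obtain ⟨hij, hjk, hki⟩ := hc.ne
  have hj : ∀ X, X = chamber i j ∨ X = chamber j k ∨ X = chamber k i → j ∉ X := by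
    rintro X (rfl | rfl | rfl) hX
    · exact (H.fst.ne hX).2.1 rfl
    · exact (H.snd.ne hX).2.1 rfl
    · exact (H.trd.ne hX).2.1 rfl
  -- Leg `j` is the only fixed leg that is kept, and the only link between the first chamber and the
  -- other two.
  have hset : ({i, k} : Finset (Particle n))ᶜ =
      insert j (chamber i j) ∪ (chamber j k ∪ chamber k i) := by
    rw [Finset.insert_union, ← H.cover]
    ext x
    simp only [Finset.mem_compl, Finset.mem_insert, Finset.mem_singleton]
    by_cases hx : x = j
    · subst hx
      simp [hij.symm, hjk]
    · tauto
  have hzero : ∀ a ∈ chamber i j, ∀ b ∈ chamber j k ∪ chamber k i, aMatrix s u a b = 0 := by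
    intro a ha b hb
    unfold aMatrix
    split_ifs with hab
    · rfl
    rcases Finset.mem_union.1 hb with hb | hb
    · obtain ⟨h1, h2, h3⟩ := H.snd.ne hb
      rw [H.fst.decoupled a ha b (Finset.disjoint_right.1 H.disj₁₂ hb) h1 h2 h3, zero_div]
    · obtain ⟨h1, h2, h3⟩ := H.trd.ne hb
      rw [H.fst.decoupled a ha b (Finset.disjoint_right.1 H.disj₁₃ hb) h1 h2 h3, zero_div]
  rw [detRemove_eq_blockDet, hset, blockDet_insert_union _ _ (hj _ (by tauto)) _ hzero _ h₀,
    blockDet_union _ H.disj₂₃]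
  · intro a ha b hb
    obtain ⟨h1, h2, h3⟩ := H.snd.ne hb
    unfold aMatrix
    split_ifs with hab
    · rfl
    rw [H.trd.decoupled a ha b (Finset.disjoint_left.1 H.disj₂₃ hb) h1 h2 h3, zero_div]
  · rw [Finset.disjoint_union_right]
    exact ⟨H.disj₁₂, H.disj₁₃⟩
  · rw [Finset.mem_union, not_or]
    exact ⟨hj _ (by tauto), hj _ (by tauto)⟩
  · intro a ha b hb
    rw [aMatrix_swap hs.symm, hzero b hb a ha, neg_zero]

theorem card_chamber {x y : Particle n} (hxy : x < y) :
    (chamber x y).card = (y : ℕ) - x - 1 := by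
  rw [← Nat.card_Ioo, ← Finset.card_map (Function.Embedding.subtype _)]
  congr 1
  ext m
  simp only [Finset.mem_map, mem_chamber, Function.Embedding.coe_subtype, Finset.mem_Ioo, CycLt]
  have hx := Finset.mem_Icc.1 x.2
  have hy := Finset.mem_Icc.1 y.2
  simp only [← Subtype.coe_lt_coe] at *
  constructor
  · rintro ⟨a, ha, rfl⟩
    omega
  · intro hm
    exact ⟨⟨m, Finset.mem_Icc.2 (by omega)⟩, Or.inl hm, rfl⟩

theorem blockDet_aMatrix_chamber_eq_zero {s : Matrix (Particle n) (Particle n) ℂ}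
    (hs : IsMandelstam s) {x y : Particle n} (hxy : x < y) (hx : Odd (x : ℕ)) (hy : Odd (y : ℕ))
    (u : Particle n → ℂ × ℂ) : blockDet (aMatrix s u) (chamber x y) = 0 := by
  apply blockDet_eq_zero_of_odd _ (aMatrix_swap hs.symm u)
  rw [card_chamber hxy]
  rw [← Subtype.coe_lt_coe] at hxy
  obtain ⟨a, ha⟩ := hx
  obtain ⟨b, hb⟩ := hy
  exact ⟨b - a - 1, by omega⟩

theorem parkeTaylor_of_gaugeFixed {L : Type} {p q r : L} {v : L → ℂ × ℂ}
    (hv : GaugeFixed p q r v) : parkeTaylor v [p, q, r] = 1 := by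
  simp [parkeTaylor, bracket, hv.zero, hv.one, hv.infty]

theorem reducedDet_of_gaugeFixed {L : Type} [Fintype L] [DecidableEq L] (G : Matrix L L ℂ)
    {p q r : L} {v : L → ℂ × ℂ} (hv : GaugeFixed p q r v) :
    reducedDet G v p r = detRemove (aMatrix G v) {p, r} := by
  simp [reducedDet, bracket, hv.zero, hv.infty]

/-- Reconciles the pairwise form of `NoCollision` with the gluing lemma, which controls brackets one
chamber (with its three fixed legs) at a time. -/
theorem exists_chamber_of_not_interlaces {i j k : Particle n} (hc : CycLt i j k) {a b : Particle n}
    (hI : ¬Interlaces i j k a b) :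
    ∃ X, (X = chamber i j ∨ X = chamber j k ∨ X = chamber k i) ∧
      (a = i ∨ a = j ∨ a = k ∨ a ∈ X) ∧ (b = i ∨ b = j ∨ b = k ∨ b ∈ X) := by
  have mem : ∀ c, (c = i ∨ c = j ∨ c = k) ∨
      c ∈ chamber i j ∨ c ∈ chamber j k ∨ c ∈ chamber k i := fun c => by
    simpa only [mem_chamber] using hc.cases c
  have fixed : ∀ {c : Particle n}, (c = i ∨ c = j ∨ c = k) → ∀ X : Finset (Particle n),
      c = i ∨ c = j ∨ c = k ∨ c ∈ X := fun h X => by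
    rcases h with h | h | h
    · exact Or.inl h
    · exact Or.inr (Or.inl h)
    · exact Or.inr (Or.inr (Or.inl h))
  have free : ∀ {c : Particle n} {X : Finset (Particle n)}, c ∈ X →
      c = i ∨ c = j ∨ c = k ∨ c ∈ X := fun h => Or.inr (Or.inr (Or.inr h))
  have one : ∀ c, ∃ X, (X = chamber i j ∨ X = chamber j k ∨ X = chamber k i) ∧
      (c = i ∨ c = j ∨ c = k ∨ c ∈ X) := fun c => by
    rcases mem c with h | h | h | h
    · exact ⟨_, Or.inl rfl, fixed h _⟩
    · exact ⟨_, Or.inl rfl, free h⟩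
    · exact ⟨_, Or.inr (Or.inl rfl), free h⟩
    · exact ⟨_, Or.inr (Or.inr rfl), free h⟩
  by_cases ha : a = i ∨ a = j ∨ a = k
  · obtain ⟨X, hX, hb⟩ := one b
    exact ⟨X, hX, fixed ha X, hb⟩
  by_cases hb : b = i ∨ b = j ∨ b = k
  · obtain ⟨X, hX, ha⟩ := one a
    exact ⟨X, hX, ha, fixed hb X⟩
  simp only [Interlaces, ← mem_chamber, not_or, not_and] at hI
  obtain ⟨⟨h1, h2, h3⟩, h4, h5, h6⟩ := hI
  rcases (mem a).resolve_left ha with ha | ha | ha <;>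
    rcases (mem b).resolve_left hb with hb | hb | hb
  · exact ⟨_, Or.inl rfl, free ha, free hb⟩
  · exact absurd hb (h2 ha)
  · exact absurd ha (h4 hb)
  · exact absurd ha (h5 hb)
  · exact ⟨_, Or.inr (Or.inl rfl), free ha, free hb⟩
  · exact absurd hb (h3 ha)
  · exact absurd hb (h1 ha)
  · exact absurd ha (h6 hb)
  · exact ⟨_, Or.inr (Or.inr rfl), free ha, free hb⟩

/-- Leg `j` is gauge-fixed but not removed, so this current is the one that receives the enlarged
block of `detRemove_aMatrix_split`. -/
theorem detRemove_currentIJ (s : Matrix (Particle n) (Particle n) ℂ) {i j k : Particle n}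
    (hc : CycLt i j k) (u : Particle n → ℂ × ℂ) :
    detRemove (aMatrix (offShellGram s (block i j)) (u ∘ legLabel k))
      {some (blockFst i j), none} = blockDet (aMatrix s u) (insert j (chamber i j)) := by
  refine detRemove_aMatrix_offShellGram s hc.not_mem_block u (by simp) fun x => ?_
  rw [Finset.mem_insert, mem_chamber_iff_legLabel hc]
  constructor
  · rintro (rfl | ⟨o, ⟨h1, h2, h3⟩, rfl⟩)
    · refine ⟨some (blockSnd i x), ?_, rfl⟩
      have : blockSnd i x ≠ blockFst i x := fun h => hc.ne.1 (congrArg Subtype.val h).symm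
      simp [this]
    · exact ⟨o, by simp [h1, h3], rfl⟩
  · rintro ⟨o, ho, rfl⟩
    simp only [Finset.mem_insert, Finset.mem_singleton, not_or] at ho
    by_cases h2 : o = some (blockSnd i j)
    · left
      rw [h2]
      rfl
    · exact Or.inr ⟨o, ⟨ho.1, h2, ho.2⟩, rfl⟩

theorem detRemove_mixedCurrent (s : Matrix (Particle n) (Particle n) ℂ) {x y z : Particle n}
    (hc : CycLt x y z) (u : Particle n → ℂ × ℂ) {β : Finset (Option ↥(block x y))}
    (hβ : ∀ o, o ∈ β ↔ o = some (blockFst x y) ∨ o = some (blockSnd x y) ∨ o = none) :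
    detRemove (aMatrix (offShellGram s (block x y)) (u ∘ legLabel z)) β =
      blockDet (aMatrix s u) (chamber x y) := by
  refine detRemove_aMatrix_offShellGram s hc.not_mem_block u ((hβ _).2 (by tauto)) fun a => ?_
  rw [mem_chamber_iff_legLabel hc]
  exact exists_congr fun o => by rw [hβ, not_or, not_or]

/-- The splitting of the amplitude in the gauge adapted to the split kinematics. -/
theorem sGalAmplitude_split {s : Matrix (Particle n) (Particle n) ℂ} (hs : IsMandelstam s)
    {i j k : Particle n} (hsp : IsSplit i j k s) (hc : CycLt i j k) (hnc : NoCollision i j k s)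
    (h₀ : ∀ u, blockDet (aMatrix s u) (chamber i j) = 0) :
    sGalAmplitude s i j k i k = currentIJ s i j * (currentJK s j k * currentKI s k i) := by
  have H := isSplitting hs hsp hc
  unfold sGalAmplitude currentIJ currentJK currentKI sGalCurrent sGalMixedCurrent
  apply H.chyIntegral
  · intro u hu h1 h2 h3 hsc
    have key : ∀ a b, a ≠ b → ¬Interlaces i j k a b → bracket u a b ≠ 0 := by
      intro a b hab hI
      obtain ⟨X, rfl | rfl | rfl, ha, hb⟩ := exists_chamber_of_not_interlaces hc hI
      · obtain ⟨a, rfl⟩ := H.fst.exists_eq ha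
        obtain ⟨b, rfl⟩ := H.fst.exists_eq hb
        exact h1 a b hab
      · obtain ⟨a, rfl⟩ := H.snd.exists_eq ha
        obtain ⟨b, rfl⟩ := H.snd.exists_eq hb
        exact h2 a b hab
      · obtain ⟨a, rfl⟩ := H.trd.exists_eq ha
        obtain ⟨b, rfl⟩ := H.trd.exists_eq hb
        exact h3 a b hab
    intro a b hab
    by_cases hI : Interlaces i j k a b
    · exact hnc u hu key hsc a b hI
    · exact key a b hab hI
  · intro u hu
    have g1 := H.fst.gaugeFixed hu.1
    have g2 := H.snd.gaugeFixed hu.1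
    have g3 := H.trd.gaugeFixed hu.1
    -- All Faddeev-Popov and Parke-Taylor factors equal one in these gauges, so only the minors have
    -- to be matched.
    rw [hu.1.faddeevPopov, g1.faddeevPopov, g2.faddeevPopov, g3.faddeevPopov,
      parkeTaylor_of_gaugeFixed g2, parkeTaylor_of_gaugeFixed g3, reducedDet_of_gaugeFixed _ hu.1,
      reducedDet_of_gaugeFixed _ g1, detRemove_aMatrix_split hs hsp hc u (h₀ u),
      detRemove_currentIJ s hc, detRemove_mixedCurrent s hc.rot u, detRemove_mixedCurrent s
      hc.rot.rot u]
    · ring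
    · intro o
      simp only [List.mem_toFinset, List.mem_cons, List.not_mem_nil, or_false]
      tauto
    · intro o
      simp only [List.mem_toFinset, List.mem_cons, List.not_mem_nil, or_false]
      tauto

end Particles
end Split

end

/-! ### The four claims. -/

theorem mainTheorem3 (n : ℕ) (s : Matrix (Split.Particle n) (Split.Particle n) ℂ)
    (hs : Split.IsMandelstam s) (i j k : Split.Particle n) (hi : (i : ℕ) = 1)
    (hij : i < j) (hjk : j < k) (hsplit : Split.IsSplit i j k s) :
    (Odd (j : ℕ) → Even (k : ℕ) → Split.NoCollision i j k s →
      ∀ p q r a b : Split.Particle n, p ≠ q → q ≠ r → r ≠ p → a ≠ b →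
        Split.sGalAmplitude s p q r a b =
          Split.currentIJ s i j * Split.currentJK s j k * Split.currentKI s k i) ∧
    (Odd (j : ℕ) → Odd (k : ℕ) →
      ∀ p q r a b : Split.Particle n, p ≠ q → q ≠ r → r ≠ p → a ≠ b →
        Split.sGalAmplitude s p q r a b = 0) ∧
    (Split.CurrentsRegular i j k s →
      ∀ p q r : Split.Particle n, p ≠ q → q ≠ r → r ≠ p → Split.CHYRegular s p q r) ∧
    (∀ S : Finset (Split.Particle n),
      (∀ a ∈ S, ∀ b ∈ S, a ≠ b → Split.Interlaces i j k a b) → Split.channel s S = 0) := by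
  have hc : Split.CycLt i j k := Or.inl ⟨hij, hjk⟩
  obtain ⟨nij, njk, nki⟩ := hc.ne
  have hi' : Odd (i : ℕ) := by rw [hi]; exact odd_one
  refine ⟨fun hj _ hnc p q r a b hpq hqr hrp hab => ?_,
    fun hj hk p q r a b hpq hqr hrp hab => ?_, fun ⟨h1, h2, h3⟩ p q r hpq hqr hrp => ?_,
    fun S hS => ?_⟩
  · rw [mul_assoc, Split.sGalAmplitude_eq hs.symm hs.massless hs.conservation hpq hqr hrp nij njk
      nki hab nki.symm]
    exact Split.sGalAmplitude_split hs hsplit hc hnc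
      (Split.blockDet_aMatrix_chamber_eq_zero hs hij hi' hj)
  · rw [Split.sGalAmplitude_eq hs.symm hs.massless hs.conservation hpq hqr hrp nij njk
      nki hab nki.symm, Split.sGalAmplitude, Split.chyIntegral]
    apply finsum_mem_eq_zero_of_forall_eq_zero
    intro u hu
    -- The chamber between `j` and `k` also has odd size, so the integrand vanishes at every
    -- solution.
    rw [Split.reducedDet_of_gaugeFixed _ hu.1, Split.detRemove_aMatrix_split hs hsplit hc u
      (Split.blockDet_aMatrix_chamber_eq_zero hs hij hi' hj u),
      Split.blockDet_aMatrix_chamber_eq_zero hs hjk hj hk u]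
    simp
  · exact Split.CHYRegular.of_gauge hs.symm hs.massless hs.conservation hpq hqr hrp nij njk nki
      ((Split.isSplitting hs hsplit hc).chyRegular h1 h2 h3)
  · unfold Split.channel
    refine Finset.sum_eq_zero fun a ha => Finset.sum_eq_zero fun b hb => ?_
    rw [Finset.mem_filter] at hb
    exact hsplit a b (hS a ha b hb.1 hb.2.ne)
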